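/- **Setting.** For integers $n,p,s$, a vector $\theta\in\mathbb R^p\setminus\{0\}$ with at most $s$ nonzero coordinates ($\|\theta\|_0\le s$) and labels $z\in\{-1,1\}^n$, let $\mathbb P_{\theta,z}$ be the law of $X=[X_1,\dots,X_n]\in\mathbb R^{p\times n}$, where $X_i=z_i\theta+\varepsilon_i$ and $\varepsilon_1,\dots,\varepsilon_n$ are i.i.d. $\mathcal N(0,I_p)$. The norm $\|\cdot\|$ is Euclidean. For $\hat z,z\in\{-1,1\}^n$ put $$\ell(\hat z,z)=\min_{\pi\in\{-1,1\}}\frac1n\sum_{i=1}^n\mathbf 1(\pi\hat z_i\ne z_i).$$ *Sparse spectral clustering* with tuning parameter $\lambda$ takes a maximizer $\hat P$ of $\langle XX^T/n,P\rangle-\lambda\sum_{j,k}|P_{jk}|$ over the symmetric $p\times p$ matrices $P$ with $\operatorname{tr}P=1$ and $0\preceq P\preceq I$, takes an eigenvector $\hat u$ of $\hat P$ for its largest eigenvalue, and returns $\hat z_i=\operatorname{sgn}(\hat u^TX_i)$, where $\operatorname{sgn}(x)=1$ for $x>0$ and $\operatorname{sgn}(x)=-1$ for $x\le0$. **Theorem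 1.** (a) There is a universal constant $C_0>0$ such that for every $C\ge C_0$ there are constants $c,c'>0$, depending only on $C$, with the following property. Let $n,p,s,\theta\neq0,z$ be as above and $\kappa>0$, and suppose that $\log p\le n$, $\|\theta\|_\infty\le\kappa\le\sqrt{\log p}$, $\lambda=C(1+\kappa)\sqrt{\log(p)/n}$, and $$\tau_n^2:=\frac{s^2\log(p)(1+\kappa^2)}{n\|\theta\|^4}\le c,\qquad \tau_n\ge0.$$ Then, with $\mathbb P_{\theta,z}$-probability at least $1-8p^{-1}-2e^{-\|\theta\|/2}$, sparse spectral clustering has an output, and every possible output $\hat z$ (for any choice of the maximizer $\hat P$ and of the leading eigenvector $\hat u$) satisfies $$\ell(\hat z,z)\le 2\exp\Big(-\frac{\|\theta\|^2}{2}\big(1-c'\tau_n-\|\theta\|^{-1}\big)\Big).$$ (b) The leading exponent $\|\theta\|^2/2$ in this rate is minimax optimal as $\|\theta\|\to\infty$: there is a function $\delta:\mathbb R\to\mathbb R$ with $\delta(\Delta)\to0$ as $\Delta\to\infty$ such that for all integers $n\ge2$, $p,s\ge 0$ and all real $\kappa$ and $\Delta>0$ for which some $\theta\in\mathbb R^p$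 satisfies $\|\theta\|\ge\Delta$, $\|\theta\|_0\le s$ and $\|\theta\|_\infty\le\kappa$, $$\inf_{\hat z}\ \sup_{\substack{\|\theta\|\ge\Delta,\ \|\theta\|_0\le s,\\ \|\theta\|_\infty\le\kappa,\ z\in\{-1,1\}^n}}\mathbb E_{\theta,z}\,\ell(\hat z,z)\ \ge\ \exp\Big(-\frac{\Delta^2}{2}\big(1-\delta(\Delta)\big)\Big),$$ where the infimum is over all measurable clustering rules $\hat z=\hat z(X)\in\{-1,1\}^n$, and even over rules $\hat z(X,\theta)$ that know $\theta$. -/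

import Mathlib

open MeasureTheory ProbabilityTheory Filter Topology
open scoped ENNReal

namespace SparseClustering

noncomputable section

/-- Cluster label vectors `z ∈ {-1, 1}ⁿ`; the group `ℤˣ` is exactly `{1, -1}`. -/
abbrev Labels (n : ℕ) : Type := Fin n → ℤˣ

/-- The data `X = [X₁, …, Xₙ]`, where `X i : Fin p → ℝ` is the `i`-th observation. -/
abbrev Data (n p : ℕ) : Type := Fin n → Fin p → ℝ

/-- The sparsity `‖θ‖₀`, i.e. the number of nonzero coordinates of `θ`. -/
def l0norm {p : ℕ} (θ : EuclideanSpace ℝ (Fin p)) : ℕ := {j : Fin p | θ j ≠ 0}.ncard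

/-- The law of the data in the symmetric two-cluster model `X i = z i • θ + ε i`, where the noise
vectors `ε i` are independent with distribution `N(0, I_p)`: the coordinates `X i j` are
independent, and `X i j` has distribution `N(z i * θ j, 1)`. -/
def gmmLaw {n p : ℕ} (θ : EuclideanSpace ℝ (Fin p)) (z : Labels n) : Measure (Data n p) :=
  Measure.pi fun i : Fin n => Measure.pi fun j : Fin p =>
    gaussianReal (((z i : ℤ) : ℝ) * θ j) 1

/-- The misclustering error: the fraction of wrongly assigned labels, up to a global sign. -/
def misclustering {n : ℕ} (zhat z : Labels n) : ℝ :=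
  ⨅ π : ℤˣ, (1 / (n : ℝ)) * ∑ i : Fin n, (if π * zhat i ≠ z i then (1 : ℝ) else 0)

/-- The sign convention `sgn x = 1` for `x > 0` and `sgn x = -1` for `x ≤ 0`. -/
def sgn (x : ℝ) : ℤˣ := if 0 < x then 1 else -1

/-- The `k`-Fantope: symmetric matrices `P` with `tr P = k` and `0 ⪯ P ⪯ I`. -/
def fantope (p : ℕ) (k : ℝ) : Set (Matrix (Fin p) (Fin p) ℝ) :=
  {P | P.IsSymm ∧ P.trace = k ∧ P.PosSemidef ∧ (1 - P).PosSemidef}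

/-- The matrix `X Xᵀ / n = (1 / n) ∑ᵢ Xᵢ Xᵢᵀ`. -/
def gram {n p : ℕ} (X : Data n p) : Matrix (Fin p) (Fin p) ℝ :=
  (1 / (n : ℝ)) • ∑ i : Fin n, Matrix.vecMulVec (X i) (X i)

/-- The entrywise `ℓ¹` norm of a matrix. -/
def entryL1 {p : ℕ} (P : Matrix (Fin p) (Fin p) ℝ) : ℝ := ∑ j, ∑ k, |P j k|

/-- The penalised objective `⟨X Xᵀ / n, P⟩ - lam * ‖P‖₁`, with the trace inner product. -/
def sdpObjective {n p : ℕ} (X : Data n p) (lam : ℝ) (P : Matrix (Fin p) (Fin p) ℝ) : ℝ :=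
  ((gram X).transpose * P).trace - lam * entryL1 P

/-- `P` is a solution of the semidefinite program over the `1`-Fantope. -/
def IsSDPSolution {n p : ℕ} (X : Data n p) (lam : ℝ) (P : Matrix (Fin p) (Fin p) ℝ) : Prop :=
  P ∈ fantope p 1 ∧ IsMaxOn (sdpObjective X lam) (fantope p 1) P

/-- `u` is an eigenvector of `P` belonging to the largest eigenvalue of `P`. -/
def IsLeadingEigenvector {p : ℕ} (P : Matrix (Fin p) (Fin p) ℝ) (u : Fin p → ℝ) : Prop :=
  ∃ μ : ℝ, Module.End.HasEigenvector (Matrix.toLin' P) μ u ∧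
    ∀ ν : ℝ, Module.End.HasEigenvalue (Matrix.toLin' P) ν → ν ≤ μ

/-- `zhat` is a possible output of sparse spectral clustering run on the data `X` with tuning
parameter `lam`: the solution of the program and its leading eigenvector may be chosen freely. -/
def IsSparseSpectralOutput {n p : ℕ} (X : Data n p) (lam : ℝ) (zhat : Labels n) : Prop :=
  ∃ (P : Matrix (Fin p) (Fin p) ℝ) (u : Fin p → ℝ),
    IsSDPSolution X lam P ∧ IsLeadingEigenvector P u ∧ ∀ i : Fin n, zhat i = sgn (u ⬝ᵥ X i)

/-- The centres `θ` with `‖θ‖ ≥ Δ`, `‖θ‖₀ ≤ s` and `‖θ‖_∞ ≤ κ`. -/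
def centres (p s : ℕ) (κ Δ : ℝ) : Set (EuclideanSpace ℝ (Fin p)) :=
  {θ | Δ ≤ ‖θ‖ ∧ l0norm θ ≤ s ∧ ∀ j, |θ j| ≤ κ}

/-- The minimax expected misclustering error over all centres in `centres p s κ Δ` and all label
vectors. The clustering rules in the infimum are all measurable ones, and they are even allowed
to know `θ` (rules that do not use `θ` are those that are constant in their first argument). -/
def minimaxRisk (n p s : ℕ) (κ Δ : ℝ) : ℝ≥0∞ :=
  ⨅ (zhat : EuclideanSpace ℝ (Fin p) → Data n p → Labels n) (_ : ∀ θ, Measurable (zhat θ)),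
    ⨆ (θ : EuclideanSpace ℝ (Fin p)) (_ : θ ∈ centres p s κ Δ) (z : Labels n),
      ∫⁻ X, ENNReal.ofReal (misclustering (zhat θ X) z) ∂(gmmLaw θ z)

end

end SparseClustering

namespace SparseClustering

section LinearAlgebra

open Matrix

/-- The entrywise (trace) inner product of two matrices. -/
def matInner {p : ℕ} (A B : Matrix (Fin p) (Fin p) ℝ) : ℝ := ∑ j, ∑ k, A j k * B j k

/-- The entrywise `ℓ¹`-penalised linear objective. -/
def penalized {p : ℕ} (A : Matrix (Fin p) (Fin p) ℝ) (lam : ℝ)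
    (P : Matrix (Fin p) (Fin p) ℝ) : ℝ :=
  matInner A P - lam * entryL1 P

/-- The matrix `H` vanishes outside `S × S`. -/
def SuppOn {p : ℕ} (S : Finset (Fin p)) (H : Matrix (Fin p) (Fin p) ℝ) : Prop :=
  ∀ j k, (j ∉ S ∨ k ∉ S) → H j k = 0

variable {p : ℕ}

lemma sdpObjective_eq_penalized {n : ℕ} (X : Data n p) (lam : ℝ)
    (P : Matrix (Fin p) (Fin p) ℝ) : sdpObjective X lam P = penalized (gram X) lam P := by
  unfold sdpObjective penalized matInner
  congr 1
  simp only [trace, diag, mul_apply, transpose_apply]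
  rw [Finset.sum_comm]

lemma matInner_add_right (A B C : Matrix (Fin p) (Fin p) ℝ) :
    matInner A (B + C) = matInner A B + matInner A C := by
  simp [matInner, mul_add, Finset.sum_add_distrib]

lemma matInner_sub_right (A B C : Matrix (Fin p) (Fin p) ℝ) :
    matInner A (B - C) = matInner A B - matInner A C := by
  simp [matInner, mul_sub, Finset.sum_sub_distrib]

lemma matInner_smul_right (A B : Matrix (Fin p) (Fin p) ℝ) (c : ℝ) :
    matInner A (c • B) = c * matInner A B := by
  simp [matInner, Finset.mul_sum, mul_left_comm]

lemma dotProduct_mulVec_eq_sum (P : Matrix (Fin p) (Fin p) ℝ) (x y : Fin p → ℝ) :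
    x ⬝ᵥ P *ᵥ y = ∑ j, ∑ k, x j * P j k * y k := by
  simp [dotProduct, mulVec, Finset.mul_sum, mul_assoc]

lemma entryL1_nonneg (H : Matrix (Fin p) (Fin p) ℝ) : 0 ≤ entryL1 H :=
  Finset.sum_nonneg fun _ _ => Finset.sum_nonneg fun _ _ => abs_nonneg _

lemma entryL1_add_le (H K : Matrix (Fin p) (Fin p) ℝ) :
    entryL1 (H + K) ≤ entryL1 H + entryL1 K := by
  simp only [entryL1, ← Finset.sum_add_distrib]
  exact Finset.sum_le_sum fun _ _ => Finset.sum_le_sum fun _ _ => abs_add_le _ _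

lemma entryL1_sub_le (H K : Matrix (Fin p) (Fin p) ℝ) :
    entryL1 (H - K) ≤ entryL1 H + entryL1 K := by
  simp only [entryL1, ← Finset.sum_add_distrib]
  exact Finset.sum_le_sum fun _ _ => Finset.sum_le_sum fun _ _ => abs_sub _ _

lemma entryL1_smul (c : ℝ) (H : Matrix (Fin p) (Fin p) ℝ) :
    entryL1 (c • H) = |c| * entryL1 H := by
  simp [entryL1, Finset.mul_sum, abs_mul]

lemma trace_vecMulVec_self (u : Fin p → ℝ) : (vecMulVec u u).trace = u ⬝ᵥ u := by
  simp [trace, vecMulVec_apply, dotProduct]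

lemma quadForm_vecMulVec (u x : Fin p → ℝ) : x ⬝ᵥ vecMulVec u u *ᵥ x = (u ⬝ᵥ x) ^ 2 := by
  rw [dotProduct_mulVec_eq_sum, sq, dotProduct, Finset.sum_mul_sum]
  refine Finset.sum_congr rfl fun j _ => Finset.sum_congr rfl fun k _ => ?_
  simp only [vecMulVec_apply]; ring

lemma posSemidef_vecMulVec (u : Fin p → ℝ) : (vecMulVec u u).PosSemidef := by
  simpa using posSemidef_vecMulVec_self_star u

lemma posSemidef_of_quadForm {P : Matrix (Fin p) (Fin p) ℝ} (hs : P.IsSymm)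
    (h : ∀ x : Fin p → ℝ, 0 ≤ x ⬝ᵥ P *ᵥ x) : P.PosSemidef :=
  .of_dotProduct_mulVec_nonneg (by rw [IsHermitian, conjTranspose_eq_transpose_of_trivial]; exact hs)
    (by simpa using h)

lemma quadForm_nonneg {P : Matrix (Fin p) (Fin p) ℝ} (h : P.PosSemidef) (x : Fin p → ℝ) :
    0 ≤ x ⬝ᵥ P *ᵥ x := by simpa using h.dotProduct_mulVec_nonneg x

lemma isSymm_of_posSemidef {P : Matrix (Fin p) (Fin p) ℝ} (h : P.PosSemidef) : P.IsSymm := by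
  have := h.1
  rwa [IsHermitian, conjTranspose_eq_transpose_of_trivial] at this

lemma diag_nonneg_of_posSemidef {P : Matrix (Fin p) (Fin p) ℝ} (h : P.PosSemidef) (j : Fin p) :
    0 ≤ P j j := by
  have := quadForm_nonneg h (Pi.single j 1)
  simpa using this

lemma sq_entry_le {P : Matrix (Fin p) (Fin p) ℝ} (h : P.PosSemidef) (j k : Fin p) :
    P j k ^ 2 ≤ P j j * P k k := by
  have hs : P k j = P j k := (isSymm_of_posSemidef h).apply j k
  have key : ∀ x : ℝ, 0 ≤ P j j * (x * x) + (2 * P j k) * x + P k k := by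
    intro x
    have := quadForm_nonneg h (x • Pi.single j 1 + Pi.single k 1)
    simp only [mulVec_add, mulVec_smul, add_dotProduct, dotProduct_add, smul_dotProduct,
      dotProduct_smul, single_one_dotProduct, mulVec_single_one, smul_eq_mul, col_apply, hs] at this
    linarith
  have := discrim_le_zero key
  rw [discrim] at this
  nlinarith

lemma abs_entry_le_sqrt {P : Matrix (Fin p) (Fin p) ℝ} (h : P.PosSemidef) (j k : Fin p) :
    |P j k| ≤ √(P j j) * √(P k k) := by
  rw [← Real.sqrt_mul (diag_nonneg_of_posSemidef h j), ← Real.sqrt_sq_eq_abs]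
  exact Real.sqrt_le_sqrt (sq_entry_le h j k)

lemma abs_entry_le_half {P : Matrix (Fin p) (Fin p) ℝ} (h : P.PosSemidef) (j k : Fin p) :
    |P j k| ≤ (P j j + P k k) / 2 := by
  have h1 := abs_entry_le_sqrt h j k
  have h2 := Real.sq_sqrt (diag_nonneg_of_posSemidef h j)
  have h3 := Real.sq_sqrt (diag_nonneg_of_posSemidef h k)
  nlinarith [sq_nonneg (√(P j j) - √(P k k))]

lemma quadForm_le_trace {P : Matrix (Fin p) (Fin p) ℝ} (h : P.PosSemidef) (x : Fin p → ℝ) :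
    x ⬝ᵥ P *ᵥ x ≤ P.trace * (x ⬝ᵥ x) := by
  have h1 : x ⬝ᵥ P *ᵥ x ≤ (∑ j, √(P j j) * |x j|) ^ 2 := by
    rw [dotProduct_mulVec_eq_sum, sq, Finset.sum_mul_sum]
    refine Finset.sum_le_sum fun j _ => Finset.sum_le_sum fun k _ => ?_
    calc x j * P j k * x k ≤ |x j * P j k * x k| := le_abs_self _
      _ = |P j k| * (|x j| * |x k|) := by rw [abs_mul, abs_mul]; ring
      _ ≤ (√(P j j) * √(P k k)) * (|x j| * |x k|) := by
          gcongr; exact abs_entry_le_sqrt h j k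
      _ = _ := by ring
  refine h1.trans ((Finset.sum_mul_sq_le_sq_mul_sq _ _ _).trans (le_of_eq ?_))
  congr 1
  · exact Finset.sum_congr rfl fun j _ => Real.sq_sqrt (diag_nonneg_of_posSemidef h j)
  · exact Finset.sum_congr rfl fun j _ => by rw [sq_abs, sq]

lemma trace_nonneg_of_posSemidef {P : Matrix (Fin p) (Fin p) ℝ} (h : P.PosSemidef) :
    0 ≤ P.trace := Finset.sum_nonneg fun j _ => diag_nonneg_of_posSemidef h j

lemma mem_fantope_one_iff {P : Matrix (Fin p) (Fin p) ℝ} :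
    P ∈ fantope p 1 ↔ P.PosSemidef ∧ P.trace = 1 := by
  constructor
  · rintro ⟨-, h2, h3, -⟩
    exact ⟨h3, h2⟩
  · rintro ⟨h1, h2⟩
    refine ⟨isSymm_of_posSemidef h1, h2, h1, posSemidef_of_quadForm ?_ fun x => ?_⟩
    · rw [IsSymm, transpose_sub, transpose_one, isSymm_of_posSemidef h1]
    · have := quadForm_le_trace h1 x
      rw [sub_mulVec, one_mulVec, dotProduct_sub]
      rw [h2] at this
      linarith

lemma entry_eq_zero_of_diag_eq_zero {P : Matrix (Fin p) (Fin p) ℝ} (h : P.PosSemidef)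
    {j k : Fin p} (h0 : P j j = 0 ∨ P k k = 0) : P j k = 0 := by
  have := sq_entry_le h j k
  have h2 : P j j * P k k = 0 := by rcases h0 with h0 | h0 <;> simp [h0]
  rw [h2] at this
  exact pow_eq_zero_iff two_ne_zero |>.1 (le_antisymm this (sq_nonneg _))

lemma eq_zero_of_trace_eq_zero {P : Matrix (Fin p) (Fin p) ℝ} (h : P.PosSemidef)
    (h0 : P.trace = 0) : P = 0 := by
  have := (Finset.sum_eq_zero_iff_of_nonneg fun j _ => diag_nonneg_of_posSemidef h j).1 h0
  ext j k
  exact entry_eq_zero_of_diag_eq_zero h (Or.inl (this j (Finset.mem_univ _)))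

lemma entryL1_le_card_mul_trace {P : Matrix (Fin p) (Fin p) ℝ} (h : P.PosSemidef)
    {S : Finset (Fin p)} (hS : SuppOn S P) : entryL1 P ≤ S.card * P.trace := by
  have e1 : entryL1 P = ∑ j ∈ S, ∑ k ∈ S, |P j k| := by
    unfold entryL1
    rw [← Finset.sum_subset (Finset.subset_univ S)]
    · refine Finset.sum_congr rfl fun j _ => ?_
      rw [← Finset.sum_subset (Finset.subset_univ S)]
      intro k _ hk
      rw [hS j k (Or.inr hk), abs_zero]
    · intro j _ hj
      exact Finset.sum_eq_zero fun k _ => by rw [hS j k (Or.inl hj), abs_zero]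
  have e2 : P.trace = ∑ j ∈ S, P j j := by
    unfold trace
    rw [← Finset.sum_subset (Finset.subset_univ S)]
    · rfl
    · intro j _ hj
      exact hS j j (Or.inl hj)
  rw [e1]
  calc ∑ j ∈ S, ∑ k ∈ S, |P j k| ≤ ∑ j ∈ S, ∑ k ∈ S, (P j j + P k k) / 2 :=
        Finset.sum_le_sum fun j _ => Finset.sum_le_sum fun k _ => abs_entry_le_half h j k
    _ = S.card * P.trace := by
        rw [e2]
        simp only [add_div, Finset.sum_add_distrib, Finset.sum_const, nsmul_eq_mul,
          ← Finset.mul_sum, ← Finset.sum_div]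
        ring

lemma suppOn_vecMulVec {S : Finset (Fin p)} {u : Fin p → ℝ} (hu : ∀ j ∉ S, u j = 0) :
    SuppOn S (vecMulVec u u) := by
  rintro j k (h | h) <;> simp [vecMulVec_apply, hu _ h]

lemma entryL1_vecMulVec_le {S : Finset (Fin p)} {u : Fin p → ℝ} (hu : ∀ j ∉ S, u j = 0) :
    entryL1 (vecMulVec u u) ≤ S.card * (u ⬝ᵥ u) := by
  have := entryL1_le_card_mul_trace (posSemidef_vecMulVec u) (suppOn_vecMulVec hu)
  rwa [trace_vecMulVec_self] at this

/-- Inner products with a matrix entrywise close to `t tᵀ + I`. -/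
lemma abs_matInner_sub_le {A : Matrix (Fin p) (Fin p) ℝ} {t : Fin p → ℝ} {e : ℝ}
    (hA : ∀ j k, |A j k - t j * t k - (1 : Matrix (Fin p) (Fin p) ℝ) j k| ≤ e)
    (H : Matrix (Fin p) (Fin p) ℝ) :
    |matInner A H - (t ⬝ᵥ H *ᵥ t + H.trace)| ≤ e * entryL1 H := by
  have h1 : H.trace = ∑ j, ∑ k, (1 : Matrix (Fin p) (Fin p) ℝ) j k * H j k := by
    simp [trace, one_apply]
  have h2 : matInner A H - (t ⬝ᵥ H *ᵥ t + H.trace)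
      = ∑ j, ∑ k, (A j k - t j * t k - (1 : Matrix (Fin p) (Fin p) ℝ) j k) * H j k := by
    rw [h1, dotProduct_mulVec_eq_sum, matInner, ← Finset.sum_add_distrib, ← Finset.sum_sub_distrib]
    refine Finset.sum_congr rfl fun j _ => ?_
    rw [← Finset.sum_add_distrib, ← Finset.sum_sub_distrib]
    exact Finset.sum_congr rfl fun k _ => by ring
  rw [h2, entryL1, Finset.mul_sum]
  refine (Finset.abs_sum_le_sum_abs _ _).trans (Finset.sum_le_sum fun j _ => ?_)
  rw [Finset.mul_sum]
  refine (Finset.abs_sum_le_sum_abs _ _).trans (Finset.sum_le_sum fun k _ => ?_)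
  rw [abs_mul]
  exact mul_le_mul_of_nonneg_right (hA j k) (abs_nonneg _)

lemma dotProduct_sq_le (x y : Fin p → ℝ) : (x ⬝ᵥ y) ^ 2 ≤ (x ⬝ᵥ x) * (y ⬝ᵥ y) := by
  have := Finset.sum_mul_sq_le_sq_mul_sq Finset.univ x y
  simpa [dotProduct, sq] using this

lemma dotProduct_self_nonneg' (x : Fin p → ℝ) : 0 ≤ x ⬝ᵥ x :=
  Finset.sum_nonneg fun _ _ => mul_self_nonneg _

end LinearAlgebra

section Deterministic

open Matrix

variable {p : ℕ}

/-- The matrix `A` is entrywise `e`-close to `T² v vᵀ + I`, where `v` is a unit vector supported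
on `S`, and the penalty level `lam ≥ e` is small compared with the spectral gap `T²`. -/
structure NearSpike (A : Matrix (Fin p) (Fin p) ℝ) (lam : ℝ) (S : Finset (Fin p)) (v : Fin p → ℝ)
    (T e β : ℝ) : Prop where
  close : ∀ j k, |A j k - (T • v) j * (T • v) k - (1 : Matrix (Fin p) (Fin p) ℝ) j k| ≤ e
  e_nonneg : 0 ≤ e
  e_le : e ≤ lam
  unit : v ⬝ᵥ v = 1
  supp : ∀ j ∉ S, v j = 0
  T_pos : 0 < T
  gap : 2 * lam * S.card ≤ β * T ^ 2
  β_le : β ≤ 1 / 8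

namespace NearSpike

variable {A : Matrix (Fin p) (Fin p) ℝ} {lam : ℝ} {S : Finset (Fin p)} {v : Fin p → ℝ}
  {T e β : ℝ}

lemma lam_nonneg (h : NearSpike A lam S v T e β) : 0 ≤ lam := h.e_nonneg.trans h.e_le

lemma matInner_le (h : NearSpike A lam S v T e β) (H : Matrix (Fin p) (Fin p) ℝ) :
    matInner A H ≤ T ^ 2 * (v ⬝ᵥ H *ᵥ v) + H.trace + e * entryL1 H := by
  have := (abs_le.1 (abs_matInner_sub_le h.close H)).2
  rw [mulVec_smul, smul_dotProduct, dotProduct_smul, smul_eq_mul, smul_eq_mul] at this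
  linarith

lemma le_matInner (h : NearSpike A lam S v T e β) (H : Matrix (Fin p) (Fin p) ℝ) :
    T ^ 2 * (v ⬝ᵥ H *ᵥ v) + H.trace - e * entryL1 H ≤ matInner A H := by
  have := (abs_le.1 (abs_matInner_sub_le h.close H)).1
  rw [mulVec_smul, smul_dotProduct, dotProduct_smul, smul_eq_mul, smul_eq_mul] at this
  linarith

lemma le_matInner_spike (h : NearSpike A lam S v T e β) :
    T ^ 2 + 1 - e * S.card ≤ matInner A (vecMulVec v v) := by
  have h1 := h.le_matInner (vecMulVec v v)
  have h2 := entryL1_vecMulVec_le h.supp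
  rw [quadForm_vecMulVec, trace_vecMulVec_self, h.unit] at h1
  rw [h.unit] at h2
  nlinarith [h.e_nonneg]

lemma vecMulVec_mem_fantope {u : Fin p → ℝ} (hu : u ⬝ᵥ u = 1) :
    vecMulVec u u ∈ fantope p 1 :=
  mem_fantope_one_iff.2 ⟨posSemidef_vecMulVec u, by rw [trace_vecMulVec_self, hu]⟩

/-- Maximisers of the penalised program have no false positives. -/
lemma suppOn_of_isMaxOn (h : NearSpike A lam S v T e β) {P : Matrix (Fin p) (Fin p) ℝ}
    (hP : P ∈ fantope p 1) (hmax : IsMaxOn (penalized A lam) (fantope p 1) P) : SuppOn S P := by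
  classical
  obtain ⟨hpsd, htr⟩ := mem_fantope_one_iff.1 hP
  obtain ⟨PS, hPS⟩ : ∃ PS : Matrix (Fin p) (Fin p) ℝ,
      ∀ j k, PS j k = if j ∈ S ∧ k ∈ S then P j k else 0 := ⟨fun _ _ => _, fun _ _ => rfl⟩
  have hPSpsd : PS.PosSemidef := by
    refine posSemidef_of_quadForm ?_ fun x => ?_
    · ext j k
      simp only [transpose_apply, hPS, (isSymm_of_posSemidef hpsd).apply j k, and_comm]
    · have := quadForm_nonneg hpsd (fun j => if j ∈ S then x j else 0)
      rw [dotProduct_mulVec_eq_sum] at this ⊢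
      refine this.trans (le_of_eq ?_)
      refine Finset.sum_congr rfl fun j _ => Finset.sum_congr rfl fun k _ => ?_
      by_cases hj : j ∈ S <;> by_cases hk : k ∈ S <;> simp [hPS, hj, hk]
  have hsplit : entryL1 P = entryL1 PS + entryL1 (P - PS) := by
    simp only [entryL1, ← Finset.sum_add_distrib]
    refine Finset.sum_congr rfl fun j _ => Finset.sum_congr rfl fun k _ => ?_
    by_cases hjk : j ∈ S ∧ k ∈ S <;> simp [Matrix.sub_apply, hPS, hjk]
  have hdiag : ∀ j, (P - PS) j j = if j ∈ S then 0 else P j j := by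
    intro j
    by_cases hj : j ∈ S <;> simp [Matrix.sub_apply, hPS, hj]
  set r := (P - PS).trace with hr
  have hr_sum : r = ∑ j, if j ∈ S then 0 else P j j := Finset.sum_congr rfl fun j _ => hdiag j
  have hterm : ∀ j ∈ Finset.univ, (0 : ℝ) ≤ if j ∈ S then 0 else P j j := by
    intro j _
    split_ifs
    exacts [le_rfl, diag_nonneg_of_posSemidef hpsd j]
  have hr0 : 0 ≤ r := by rw [hr_sum]; exact Finset.sum_nonneg hterm
  have htrPS : PS.trace = 1 - r := by rw [hr, trace_sub, htr]; ring
  have hQ : PS + r • vecMulVec v v ∈ fantope p 1 := by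
    refine mem_fantope_one_iff.2 ⟨hPSpsd.add ((posSemidef_vecMulVec v).smul hr0), ?_⟩
    rw [trace_add, trace_smul, trace_vecMulVec_self, h.unit, htrPS, smul_eq_mul]; ring
  have hle : penalized A lam (PS + r • vecMulVec v v) ≤ penalized A lam P := hmax hQ
  have hoff : v ⬝ᵥ (P - PS) *ᵥ v = 0 := by
    rw [dotProduct_mulVec_eq_sum]
    refine Finset.sum_eq_zero fun j _ => Finset.sum_eq_zero fun k _ => ?_
    by_cases hj : j ∈ S
    · by_cases hk : k ∈ S
      · simp [Matrix.sub_apply, hPS, hj, hk]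
      · simp [h.supp k hk]
    · simp [h.supp j hj]
  have h1 := h.matInner_le (P - PS)
  rw [hoff, ← hr, matInner_sub_right] at h1
  have h2 := h.le_matInner_spike
  have h3 := entryL1_add_le PS (r • vecMulVec v v)
  rw [entryL1_smul, abs_of_nonneg hr0] at h3
  have h4 := entryL1_vecMulVec_le h.supp
  rw [h.unit, mul_one] at h4
  have h5 := entryL1_nonneg (P - PS)
  unfold penalized at hle
  rw [matInner_add_right, matInner_smul_right, hsplit] at hle
  have hlam := h.lam_nonneg
  have h6 : r * (T ^ 2 + 1 - e * S.card) ≤ r * matInner A (vecMulVec v v) := by gcongr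
  have h7 : lam * entryL1 (PS + r • vecMulVec v v) ≤ lam * (entryL1 PS + r * S.card) := by
    gcongr
    exact h3.trans (by gcongr)
  have h8 : e * entryL1 (P - PS) ≤ lam * entryL1 (P - PS) := by
    gcongr; exact h.e_le
  have h9 : r * (T ^ 2 - (e + lam) * S.card) ≤ 0 := by nlinarith
  have h10 : (e + lam) * S.card ≤ 2 * lam * S.card := by
    gcongr; linarith [h.e_le]
  have hT2 : 0 < T ^ 2 := pow_pos h.T_pos 2
  have h11 : 0 < T ^ 2 - (e + lam) * S.card := by nlinarith [h.gap, h.β_le]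
  have hr00 : r = 0 := by
    by_contra hne
    have : 0 < r := lt_of_le_of_ne hr0 (Ne.symm hne)
    nlinarith
  rw [hr_sum] at hr00
  have hz := (Finset.sum_eq_zero_iff_of_nonneg hterm).1 hr00
  have hz' : ∀ j ∉ S, P j j = 0 := fun j hj => by simpa [hj] using hz j (Finset.mem_univ j)
  rintro j k (hj | hk)
  · exact entry_eq_zero_of_diag_eq_zero hpsd (Or.inl (hz' j hj))
  · exact entry_eq_zero_of_diag_eq_zero hpsd (Or.inr (hz' k hk))

/-- Maximisers of the penalised program have almost full weight in the direction `v`. -/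
lemma one_sub_le_quadForm (h : NearSpike A lam S v T e β) {P : Matrix (Fin p) (Fin p) ℝ}
    (hP : P ∈ fantope p 1) (hmax : IsMaxOn (penalized A lam) (fantope p 1) P) :
    1 - β ≤ v ⬝ᵥ P *ᵥ v := by
  have htr := (mem_fantope_one_iff.1 hP).2
  have hle : penalized A lam (vecMulVec v v) ≤ penalized A lam P :=
    hmax (vecMulVec_mem_fantope h.unit)
  have h1 := h.matInner_le (P - vecMulVec v v)
  have h2 := entryL1_sub_le P (vecMulVec v v)
  have h3 := entryL1_vecMulVec_le h.supp
  rw [h.unit, mul_one] at h3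
  rw [matInner_sub_right, sub_mulVec, dotProduct_sub, trace_sub, quadForm_vecMulVec, h.unit, htr,
    trace_vecMulVec_self, h.unit] at h1
  unfold penalized at hle
  have hlam := h.lam_nonneg
  have h4 : e * entryL1 (P - vecMulVec v v) ≤ e * (entryL1 P + entryL1 (vecMulVec v v)) :=
    mul_le_mul_of_nonneg_left h2 h.e_nonneg
  have h5 : e * entryL1 P ≤ lam * entryL1 P :=
    mul_le_mul_of_nonneg_right h.e_le (entryL1_nonneg P)
  have h6 : (e + lam) * entryL1 (vecMulVec v v) ≤ (2 * lam) * S.card := by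
    have := h.e_le
    have := entryL1_nonneg (vecMulVec v v)
    have := h.e_nonneg
    gcongr
    linarith
  have hT2 : 0 < T ^ 2 := pow_pos h.T_pos 2
  have h7 : T ^ 2 * (1 - v ⬝ᵥ P *ᵥ v) ≤ T ^ 2 * β := by nlinarith [h.gap]
  have := le_of_mul_le_mul_left h7 hT2
  linarith

/-- Maximisers of the penalised program are projections of rank one. -/
lemma eq_vecMulVec_of_isMaxOn (h : NearSpike A lam S v T e β) {P : Matrix (Fin p) (Fin p) ℝ}
    (hP : P ∈ fantope p 1) (hmax : IsMaxOn (penalized A lam) (fantope p 1) P)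
    {u : Fin p → ℝ} {μ : ℝ} (hu : u ⬝ᵥ u = 1) (hPu : P *ᵥ u = μ • u)
    (hμ : ∀ x : Fin p → ℝ, x ⬝ᵥ P *ᵥ x ≤ μ * (x ⬝ᵥ x)) :
    P = vecMulVec u u ∧ (∀ j ∉ S, u j = 0) ∧ 1 - β ≤ (u ⬝ᵥ v) ^ 2 := by
  obtain ⟨hpsd, htr⟩ := mem_fantope_one_iff.1 hP
  have hsupp := h.suppOn_of_isMaxOn hP hmax
  have hq := h.one_sub_le_quadForm hP hmax
  have hβ := h.β_le
  have hμv := hμ v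
  rw [h.unit, mul_one] at hμv
  have hμpos : 0 < μ := by linarith
  have hus : ∀ j ∉ S, u j = 0 := by
    intro j hj
    have h1 := congrFun hPu j
    have h2 : (P *ᵥ u) j = 0 := by
      simp only [mulVec, dotProduct]
      exact Finset.sum_eq_zero fun k _ => by rw [hsupp j k (Or.inl hj), zero_mul]
    rw [h2, Pi.smul_apply, smul_eq_mul] at h1
    rcases mul_eq_zero.1 h1.symm with h3 | h3
    · exact absurd h3 hμpos.ne'
    · exact h3
  set R := P - μ • vecMulVec u u with hR
  have hsym := isSymm_of_posSemidef hpsd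
  have huP : ∀ x : Fin p → ℝ, u ⬝ᵥ P *ᵥ x = μ * (u ⬝ᵥ x) := by
    intro x
    rw [dotProduct_mulVec, ← mulVec_transpose, hsym.eq, hPu, smul_dotProduct, smul_eq_mul]
  have hRq : ∀ x : Fin p → ℝ, x ⬝ᵥ R *ᵥ x
      = (x - (u ⬝ᵥ x) • u) ⬝ᵥ P *ᵥ (x - (u ⬝ᵥ x) • u) := by
    intro x
    rw [hR, sub_mulVec, smul_mulVec, dotProduct_sub, dotProduct_smul, quadForm_vecMulVec,
      mulVec_sub, mulVec_smul, hPu, sub_dotProduct, dotProduct_sub, dotProduct_sub,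
      smul_dotProduct, smul_dotProduct, huP, dotProduct_smul, dotProduct_smul, dotProduct_smul,
      dotProduct_smul, dotProduct_comm x u, hu]
    simp only [smul_eq_mul]
    ring
  have hRpsd : R.PosSemidef := by
    refine posSemidef_of_quadForm ?_ fun x => ?_
    · rw [hR, IsSymm, transpose_sub, transpose_smul, hsym.eq,
        (isSymm_of_posSemidef (posSemidef_vecMulVec u)).eq]
    · rw [hRq]; exact quadForm_nonneg hpsd _
  have hRtr : R.trace = 1 - μ := by
    rw [hR, trace_sub, trace_smul, trace_vecMulVec_self, hu, htr, smul_eq_mul, mul_one]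
  have hRsupp : SuppOn S R := by
    intro j k hjk
    simp only [hR, Matrix.sub_apply, Matrix.smul_apply, hsupp j k hjk, suppOn_vecMulVec hus j k hjk, smul_zero,
      sub_zero]
  have hμ1 : 0 ≤ 1 - μ := by rw [← hRtr]; exact trace_nonneg_of_posSemidef hRpsd
  have hPR : v ⬝ᵥ P *ᵥ v = μ * (u ⬝ᵥ v) ^ 2 + v ⬝ᵥ R *ᵥ v := by
    rw [hR, sub_mulVec, smul_mulVec, dotProduct_sub, dotProduct_smul, quadForm_vecMulVec,
      smul_eq_mul]; ring
  have hRv1 := quadForm_le_trace hRpsd v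
  rw [h.unit, hRtr, mul_one] at hRv1
  have hcos : 1 - 2 * β ≤ (u ⬝ᵥ v) ^ 2 := by nlinarith [sq_nonneg (u ⬝ᵥ v)]
  have hRv : v ⬝ᵥ R *ᵥ v ≤ (1 - μ) * (2 * β) := by
    have e1 : v ⬝ᵥ R *ᵥ v = (v - (u ⬝ᵥ v) • u) ⬝ᵥ R *ᵥ (v - (u ⬝ᵥ v) • u) := by
      rw [hRq, hRq]
      have : u ⬝ᵥ (v - (u ⬝ᵥ v) • u) = 0 := by
        rw [dotProduct_sub, dotProduct_smul, hu, smul_eq_mul, mul_one, sub_self]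
      rw [this, zero_smul, sub_zero]
    have e2 := quadForm_le_trace hRpsd (v - (u ⬝ᵥ v) • u)
    have e3 : (v - (u ⬝ᵥ v) • u) ⬝ᵥ (v - (u ⬝ᵥ v) • u) = 1 - (u ⬝ᵥ v) ^ 2 := by
      rw [sub_dotProduct, dotProduct_sub, dotProduct_sub, smul_dotProduct, dotProduct_smul,
        smul_dotProduct, dotProduct_smul, hu, h.unit, dotProduct_comm v u]
      simp only [smul_eq_mul]; ring
    rw [← e1, e3, hRtr] at e2
    exact e2.trans (mul_le_mul_of_nonneg_left (by linarith) hμ1)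
  have hQ : P - R + (1 - μ) • vecMulVec v v ∈ fantope p 1 := by
    have e1 : P - R = μ • vecMulVec u u := by rw [hR]; abel
    rw [e1]
    refine mem_fantope_one_iff.2 ⟨((posSemidef_vecMulVec u).smul hμpos.le).add
      ((posSemidef_vecMulVec v).smul hμ1), ?_⟩
    rw [trace_add, trace_smul, trace_smul, trace_vecMulVec_self, trace_vecMulVec_self, hu, h.unit]
    simp
  have hle : penalized A lam (P - R + (1 - μ) • vecMulVec v v) ≤ penalized A lam P := hmax hQ
  have hlam := h.lam_nonneg
  have h1 := h.matInner_le R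
  have h2 := h.le_matInner_spike
  have h3 := entryL1_add_le (P - R) ((1 - μ) • vecMulVec v v)
  have h3' := entryL1_sub_le P R
  rw [entryL1_smul, abs_of_nonneg hμ1] at h3
  have h4 := entryL1_vecMulVec_le h.supp
  rw [h.unit, mul_one] at h4
  have h5 := entryL1_le_card_mul_trace hRpsd hRsupp
  rw [hRtr] at h5 h1
  unfold penalized at hle
  rw [matInner_add_right, matInner_smul_right, matInner_sub_right] at hle
  have h6 : (1 - μ) * (T ^ 2 + 1 - e * S.card) ≤ (1 - μ) * matInner A (vecMulVec v v) := by
    gcongr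
  have h7 : lam * entryL1 (P - R + (1 - μ) • vecMulVec v v)
      ≤ lam * (entryL1 P + 2 * (1 - μ) * S.card) := by
    gcongr
    have : (1 - μ) * entryL1 (vecMulVec v v) ≤ (1 - μ) * S.card := by gcongr
    linarith
  have h8 : e * entryL1 R ≤ e * (S.card * (1 - μ)) := mul_le_mul_of_nonneg_left h5 h.e_nonneg
  have hT2 : 0 < T ^ 2 := pow_pos h.T_pos 2
  have h9 : T ^ 2 * (v ⬝ᵥ R *ᵥ v) ≤ T ^ 2 * ((1 - μ) * (2 * β)) := by gcongr
  have h10 : e * S.card * (1 - μ) ≤ lam * S.card * (1 - μ) := by gcongr; exact h.e_le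
  have h11 := mul_le_mul_of_nonneg_right h.gap hμ1
  have h12 : (1 - μ) * (T ^ 2 * (1 - 4 * β)) ≤ 0 := by nlinarith
  have h13 : 0 < T ^ 2 * (1 - 4 * β) := mul_pos hT2 (by linarith)
  have hμeq : 1 - μ = 0 := by
    by_contra hne
    have : 0 < 1 - μ := lt_of_le_of_ne hμ1 (Ne.symm hne)
    nlinarith
  have hR0 := eq_zero_of_trace_eq_zero hRpsd (hRtr.trans hμeq)
  have hμ' : μ = 1 := by linarith
  have hPeq : P = vecMulVec u u := by
    have := sub_eq_zero.1 (hR.symm.trans hR0)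
    rw [this, hμ', one_smul]
  refine ⟨hPeq, hus, ?_⟩
  rw [hPeq, quadForm_vecMulVec] at hq
  exact hq

/-- Quadratic growth of the penalised objective away from a rank one maximiser. -/
lemma quadratic_growth (h : NearSpike A lam S v T e β) {u w : Fin p → ℝ}
    (hmax : IsMaxOn (penalized A lam) (fantope p 1) (vecMulVec u u))
    (hu : u ⬝ᵥ u = 1) (hw : w ⬝ᵥ w = 1) (hus : ∀ j ∉ S, u j = 0) (hws : ∀ j ∉ S, w j = 0)
    (huv : 1 - β ≤ u ⬝ᵥ v) (hwv : 1 - β ≤ w ⬝ᵥ v) {d : Fin p → ℝ} (hd : u - w = (2 : ℝ) • d) :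
    T ^ 2 * (d ⬝ᵥ d) ≤ penalized A lam (vecMulVec u u) - penalized A lam (vecMulVec w w) := by
  have huw : u = w + (2 : ℝ) • d := by rw [← hd]; abel
  obtain ⟨m, hm⟩ : ∃ m, m = w + d := ⟨_, rfl⟩
  have hdd := dotProduct_self_nonneg' d
  have hds : ∀ j ∉ S, d j = 0 := by
    intro j hj
    have := congrFun hd j
    simp only [Pi.sub_apply, hus j hj, hws j hj, Pi.smul_apply, smul_eq_mul] at this
    linarith
  have hum : u = m + d := by rw [huw, hm, two_smul, add_assoc]
  have hwm : w = m - d := by rw [hm]; abel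
  have e1 : m ⬝ᵥ m + 2 * (m ⬝ᵥ d) + d ⬝ᵥ d = 1 := by
    rw [← hu, hum, add_dotProduct, dotProduct_add, dotProduct_add, dotProduct_comm d m]; ring
  have e2 : m ⬝ᵥ m - 2 * (m ⬝ᵥ d) + d ⬝ᵥ d = 1 := by
    rw [← hw, hwm, sub_dotProduct, dotProduct_sub, dotProduct_sub, dotProduct_comm d m]; ring
  have hmd : m ⬝ᵥ d = 0 := by linarith
  have hmm : m ⬝ᵥ m = 1 - d ⬝ᵥ d := by linarith
  have hmv : 1 - β ≤ m ⬝ᵥ v := by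
    rw [hum, add_dotProduct] at huv
    rw [hwm, sub_dotProduct] at hwv
    linarith
  have hvd : (d ⬝ᵥ v) ^ 2 ≤ 2 * β * (d ⬝ᵥ d) := by
    have f1 : (v - m) ⬝ᵥ d = d ⬝ᵥ v := by rw [sub_dotProduct, hmd, sub_zero, dotProduct_comm]
    have f2 := dotProduct_sq_le (v - m) d
    have f3 : (v - m) ⬝ᵥ (v - m) ≤ 2 * β := by
      rw [sub_dotProduct, dotProduct_sub, dotProduct_sub, h.unit, hmm, dotProduct_comm v m]
      linarith
    rw [f1] at f2
    exact f2.trans (mul_le_mul_of_nonneg_right f3 hdd)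
  have hmid : vecMulVec m m
      = (1 / 2 : ℝ) • vecMulVec u u + (1 / 2 : ℝ) • vecMulVec w w - vecMulVec d d := by
    ext j k
    simp only [Matrix.sub_apply, Matrix.add_apply, Matrix.smul_apply, vecMulVec_apply, hum, hwm, Pi.add_apply,
      Pi.sub_apply, smul_eq_mul]
    ring
  have hQ : vecMulVec m m + (d ⬝ᵥ d) • vecMulVec v v ∈ fantope p 1 := by
    refine mem_fantope_one_iff.2 ⟨(posSemidef_vecMulVec m).add ((posSemidef_vecMulVec v).smul hdd),
      ?_⟩
    rw [trace_add, trace_smul, trace_vecMulVec_self, trace_vecMulVec_self, h.unit, hmm]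
    simp
  have hle : penalized A lam (vecMulVec m m + (d ⬝ᵥ d) • vecMulVec v v)
      ≤ penalized A lam (vecMulVec u u) := hmax hQ
  have hlam := h.lam_nonneg
  have h1 := h.matInner_le (vecMulVec d d)
  rw [quadForm_vecMulVec, trace_vecMulVec_self] at h1
  have h2 := h.le_matInner_spike
  have h4 := entryL1_vecMulVec_le h.supp
  rw [h.unit, mul_one] at h4
  have h5 := entryL1_vecMulVec_le hds
  have h3 : entryL1 (vecMulVec m m + (d ⬝ᵥ d) • vecMulVec v v)
      ≤ 1 / 2 * entryL1 (vecMulVec u u) + 1 / 2 * entryL1 (vecMulVec w w)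
        + 2 * (S.card * (d ⬝ᵥ d)) := by
    have g1 := entryL1_add_le (vecMulVec m m) ((d ⬝ᵥ d) • vecMulVec v v)
    have g2 := entryL1_sub_le ((1 / 2 : ℝ) • vecMulVec u u + (1 / 2 : ℝ) • vecMulVec w w)
      (vecMulVec d d)
    have g3 := entryL1_add_le ((1 / 2 : ℝ) • vecMulVec u u) ((1 / 2 : ℝ) • vecMulVec w w)
    rw [← hmid] at g2
    rw [entryL1_smul, abs_of_nonneg hdd] at g1
    rw [entryL1_smul, entryL1_smul, abs_of_nonneg (by norm_num : (0 : ℝ) ≤ 1 / 2)] at g3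
    have g4 := mul_le_mul_of_nonneg_left h4 hdd
    linarith
  have h6 := mul_le_mul_of_nonneg_left h3 hlam
  have h7 : (d ⬝ᵥ d) * (T ^ 2 + 1 - e * S.card) ≤ (d ⬝ᵥ d) * matInner A (vecMulVec v v) := by
    gcongr
  have h8 : e * entryL1 (vecMulVec d d) ≤ e * (S.card * (d ⬝ᵥ d)) :=
    mul_le_mul_of_nonneg_left h5 h.e_nonneg
  have hT2 : 0 < T ^ 2 := pow_pos h.T_pos 2
  have h9 : T ^ 2 * (d ⬝ᵥ v) ^ 2 ≤ T ^ 2 * (2 * β * (d ⬝ᵥ d)) := by gcongr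
  have h10 : e * S.card * (d ⬝ᵥ d) ≤ lam * S.card * (d ⬝ᵥ d) :=
    mul_le_mul_of_nonneg_right (mul_le_mul_of_nonneg_right h.e_le (Nat.cast_nonneg _)) hdd
  have h11 := mul_le_mul_of_nonneg_right h.gap hdd
  have hT2d : 0 ≤ T ^ 2 * (d ⬝ᵥ d) := mul_nonneg hT2.le hdd
  have h12 : β * (T ^ 2 * (d ⬝ᵥ d)) ≤ 1 / 8 * (T ^ 2 * (d ⬝ᵥ d)) := by exact mul_le_mul_of_nonneg_right h.β_le hT2d
  unfold penalized at hle ⊢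
  have h13 : matInner A (vecMulVec m m) = 1 / 2 * matInner A (vecMulVec u u)
      + 1 / 2 * matInner A (vecMulVec w w) - matInner A (vecMulVec d d) := by
    rw [hmid, matInner_sub_right, matInner_add_right, matInner_smul_right, matInner_smul_right]
  rw [matInner_add_right, matInner_smul_right, h13] at hle
  nlinarith

end NearSpike

end Deterministic

section Program

open Matrix

variable {n p : ℕ}

lemma continuous_quadForm (x : Fin p → ℝ) :
    Continuous fun P : Matrix (Fin p) (Fin p) ℝ => x ⬝ᵥ P *ᵥ x := by
  fun_prop

lemma isClosed_fantope_one : IsClosed (fantope p 1) := by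
  have : fantope p 1 = {P | P.IsSymm} ∩ {P | P.trace = 1} ∩
      ⋂ x : Fin p → ℝ, {P | 0 ≤ x ⬝ᵥ P *ᵥ x} := by
    ext P
    simp only [Set.mem_inter_iff, Set.mem_ofPred_eq, Set.mem_iInter, mem_fantope_one_iff]
    constructor
    · rintro ⟨h1, h2⟩
      exact ⟨⟨isSymm_of_posSemidef h1, h2⟩, quadForm_nonneg h1⟩
    · rintro ⟨⟨h1, h2⟩, h3⟩
      exact ⟨posSemidef_of_quadForm h1 h3, h2⟩
  rw [this]
  refine ((isClosed_eq (by fun_prop) continuous_id).inter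
    (isClosed_eq (by fun_prop) continuous_const)).inter (isClosed_iInter fun x => ?_)
  exact isClosed_le continuous_const (continuous_quadForm x)

lemma isCompact_fantope_one : IsCompact (fantope p 1) := by
  have hK : IsCompact (Set.univ.pi fun _ : Fin p => Set.univ.pi fun _ : Fin p =>
      Set.Icc (-1 : ℝ) 1) :=
    isCompact_univ_pi fun _ => isCompact_univ_pi fun _ => isCompact_Icc
  refine hK.of_isClosed_subset isClosed_fantope_one fun P hP => ?_
  obtain ⟨hpsd, htr⟩ := mem_fantope_one_iff.1 hP
  have hd : ∀ j, P j j ≤ 1 := fun j => by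
    rw [← htr]
    exact Finset.single_le_sum (f := fun j => P j j)
      (fun k _ => diag_nonneg_of_posSemidef hpsd k) (Finset.mem_univ j)
  intro j _ k _
  have := abs_entry_le_half hpsd j k
  exact abs_le.1 (by linarith [hd j, hd k])

lemma continuous_penalized (lam : ℝ) :
    Continuous fun q : Matrix (Fin p) (Fin p) ℝ × Matrix (Fin p) (Fin p) ℝ =>
      penalized q.1 lam q.2 := by
  unfold penalized matInner entryL1
  fun_prop

lemma continuous_gram : Continuous fun X : Data n p => gram X := by
  unfold gram
  fun_prop

lemma exists_isSDPSolution (hp : 0 < p) (X : Data n p) (lam : ℝ) :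
    ∃ P, IsSDPSolution X lam P := by
  have hne : (fantope p 1).Nonempty := by
    refine ⟨vecMulVec (Pi.single ⟨0, hp⟩ 1) (Pi.single ⟨0, hp⟩ 1),
      NearSpike.vecMulVec_mem_fantope ?_⟩
    simp
  have hc : Continuous (sdpObjective X lam) := by
    have : sdpObjective X lam = fun P => penalized (gram X) lam P :=
      funext fun P => sdpObjective_eq_penalized X lam P
    rw [this]
    exact (continuous_penalized lam).comp (continuous_const.prodMk continuous_id)
  obtain ⟨P, hP, hmax⟩ := isCompact_fantope_one.exists_isMaxOn hne hc.continuousOn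
  exact ⟨P, hP, hmax⟩

lemma exists_isLeadingEigenvector (hp : 0 < p) {P : Matrix (Fin p) (Fin p) ℝ}
    (hP : P.IsHermitian) : ∃ u, IsLeadingEigenvector P u := by
  have : Nonempty (Fin p) := ⟨⟨0, hp⟩⟩
  obtain ⟨j, hj⟩ := Finite.exists_max hP.eigenvalues
  refine ⟨(hP.eigenvectorBasis j).ofLp, hP.eigenvalues j, ?_, fun ν hν => ?_⟩
  · rw [Module.End.hasEigenvector_iff, Module.End.mem_eigenspace_iff, toLin'_apply]
    refine ⟨hP.mulVec_eigenvectorBasis j, fun h0 => ?_⟩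
    refine hP.eigenvectorBasis.toBasis.ne_zero j ?_
    rw [OrthonormalBasis.coe_toBasis]
    ext k
    exact congrFun h0 k
  · rw [Module.End.hasEigenvalue_iff_mem_spectrum, spectrum_toLin',
      hP.spectrum_real_eq_range_eigenvalues] at hν
    obtain ⟨k, rfl⟩ := hν
    exact hj k

lemma exists_isSparseSpectralOutput (hp : 0 < p) (X : Data n p) (lam : ℝ) :
    ∃ zhat, IsSparseSpectralOutput X lam zhat := by
  obtain ⟨P, hP⟩ := exists_isSDPSolution hp X lam
  obtain ⟨u, hu⟩ := exists_isLeadingEigenvector hp (mem_fantope_one_iff.1 hP.1).1.1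
  exact ⟨fun i => sgn (u ⬝ᵥ X i), P, u, hP, hu, fun _ => rfl⟩

/-- The Rayleigh quotient characterisation of the largest eigenvalue. -/
lemma IsLeadingEigenvector.exists_rayleigh {P : Matrix (Fin p) (Fin p) ℝ} (hP : P.IsSymm)
    {u : Fin p → ℝ} (hu : IsLeadingEigenvector P u) :
    ∃ μ : ℝ, P *ᵥ u = μ • u ∧ u ≠ 0 ∧ ∀ x : Fin p → ℝ, x ⬝ᵥ P *ᵥ x ≤ μ * (x ⬝ᵥ x) := by
  obtain ⟨μ, hev, hmax⟩ := hu
  rw [Module.End.hasEigenvector_iff, Module.End.mem_eigenspace_iff, toLin'_apply] at hev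
  refine ⟨μ, hev.1, hev.2, fun x => ?_⟩
  have hpsd : (μ • (1 : Matrix (Fin p) (Fin p) ℝ) - P).PosSemidef := by
    rw [posSemidef_iff_isHermitian_and_spectrum_nonneg]
    refine ⟨?_, fun a ha => ?_⟩
    · rw [IsHermitian, conjTranspose_eq_transpose_of_trivial, transpose_sub, transpose_smul,
        transpose_one, hP.eq]
    · rw [← spectrum_toLin', ← Module.End.hasEigenvalue_iff_mem_spectrum] at ha
      obtain ⟨w, hw⟩ := ha.exists_hasEigenvector
      rw [Module.End.hasEigenvector_iff, Module.End.mem_eigenspace_iff, toLin'_apply,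
        sub_mulVec, smul_mulVec, one_mulVec] at hw
      have h1 : P *ᵥ w = (μ - a) • w := by rw [sub_smul, ← hw.1]; abel
      have h2 : Module.End.HasEigenvalue (toLin' P) (μ - a) := by
        refine Module.End.hasEigenvalue_of_hasEigenvector (x := w) ?_
        rw [Module.End.hasEigenvector_iff, Module.End.mem_eigenspace_iff, toLin'_apply]
        exact ⟨h1, hw.2⟩
      have := hmax _ h2
      simp only [Set.mem_ofPred_eq]
      linarith
  have := quadForm_nonneg hpsd x
  rw [sub_mulVec, smul_mulVec, one_mulVec, dotProduct_sub, dotProduct_smul, smul_eq_mul] at this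
  linarith

/-- The data for which some rank one solution of the program, oriented along `v`, assigns the
`i`-th label wrongly. -/
def errorSet (lam : ℝ) (v : Fin p → ℝ) (z : Labels n) (i : Fin n) : Set (Data n p) :=
  {X | ∃ u : Fin p → ℝ, u ⬝ᵥ u = 1 ∧ IsSDPSolution X lam (vecMulVec u u) ∧ 0 ≤ u ⬝ᵥ v ∧
    ((z i : ℤ) : ℝ) * (u ⬝ᵥ X i) ≤ 0}

lemma isCompact_unitVectors : IsCompact {u : Fin p → ℝ | u ⬝ᵥ u = 1} := by
  have hK : IsCompact (Set.univ.pi fun _ : Fin p => Set.Icc (-1 : ℝ) 1) :=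
    isCompact_univ_pi fun _ => isCompact_Icc
  refine hK.of_isClosed_subset (isClosed_eq (by fun_prop) continuous_const) fun u hu j _ => ?_
  have h1 : u j * u j ≤ 1 := by
    rw [← (hu : u ⬝ᵥ u = 1)]
    exact Finset.single_le_sum (f := fun j => u j * u j) (fun k _ => mul_self_nonneg _)
      (Finset.mem_univ j)
  exact abs_le.1 (abs_le_one_iff_mul_self_le_one.2 h1)

lemma isClosed_errorSet (lam : ℝ) (v : Fin p → ℝ) (z : Labels n) (i : Fin n) :
    IsClosed (errorSet lam v z i) := by
  let K : Set (Fin p → ℝ) := {u | u ⬝ᵥ u = 1}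
  have : CompactSpace K := isCompact_iff_compactSpace.1 isCompact_unitVectors
  let F : Set (K × Data n p) := {q | (∀ Q ∈ fantope p 1,
    penalized (gram q.2) lam Q ≤ penalized (gram q.2) lam (vecMulVec q.1.1 q.1.1)) ∧
    0 ≤ q.1.1 ⬝ᵥ v ∧ ((z i : ℤ) : ℝ) * (q.1.1 ⬝ᵥ q.2 i) ≤ 0}
  have hF : IsClosed F := by
    have h1 : IsClosed {q : K × Data n p | ∀ Q ∈ fantope p 1,
        penalized (gram q.2) lam Q ≤ penalized (gram q.2) lam (vecMulVec q.1.1 q.1.1)} := by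
      simp only [Set.ofPred_forall]
      refine isClosed_iInter fun Q => isClosed_iInter fun _ => isClosed_le ?_ ?_
      · exact (continuous_penalized lam).comp
          ((continuous_gram.comp continuous_snd).prodMk continuous_const)
      · exact (continuous_penalized lam).comp
          ((continuous_gram.comp continuous_snd).prodMk (Continuous.matrix_vecMulVec
            (continuous_subtype_val.comp continuous_fst)
            (continuous_subtype_val.comp continuous_fst)))
    have h2 : IsClosed {q : K × Data n p | 0 ≤ q.1.1 ⬝ᵥ v} :=
      isClosed_le continuous_const (by fun_prop)
    have h3 : IsClosed {q : K × Data n p | ((z i : ℤ) : ℝ) * (q.1.1 ⬝ᵥ q.2 i) ≤ 0} :=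
      isClosed_le (by fun_prop) continuous_const
    exact h1.inter (h2.inter h3)
  have : errorSet lam v z i = Prod.snd '' F := by
    ext X
    constructor
    · rintro ⟨u, h1, h2, h3, h4⟩
      refine ⟨(⟨u, h1⟩, X), ⟨fun Q hQ => ?_, h3, h4⟩, rfl⟩
      have := h2.2 hQ
      simpa only [Set.mem_ofPred_eq, sdpObjective_eq_penalized] using this
    · rintro ⟨⟨⟨u, h1⟩, Y⟩, ⟨h2, h3, h4⟩, rfl⟩
      refine ⟨u, h1, ⟨NearSpike.vecMulVec_mem_fantope h1, fun Q hQ => ?_⟩, h3, h4⟩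
      simpa only [Set.mem_ofPred_eq, sdpObjective_eq_penalized] using h2 Q hQ
  rw [this]
  exact isClosedMap_snd_of_compactSpace _ hF

lemma IsSDPSolution.isMaxOn_penalized {X : Data n p} {lam : ℝ} {P : Matrix (Fin p) (Fin p) ℝ}
    (h : IsSDPSolution X lam P) : IsMaxOn (penalized (gram X) lam) (fantope p 1) P := by
  intro Q hQ
  simpa only [Set.mem_ofPred_eq, sdpObjective_eq_penalized] using h.2 hQ

/-- The misclustering error of an output is at most the fraction of error sets containing the
data. -/
lemma misclustering_le_of_output {X : Data n p} {lam T e β : ℝ} {S : Finset (Fin p)}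
    {v : Fin p → ℝ} (h : NearSpike (gram X) lam S v T e β) {zhat z : Labels n}
    (hz : IsSparseSpectralOutput X lam zhat) :
    misclustering zhat z
      ≤ (1 / (n : ℝ)) * ∑ i, (errorSet lam v z i).indicator (fun _ => (1 : ℝ)) X := by
  obtain ⟨P, u, hP, hlead, hzhat⟩ := hz
  obtain ⟨hpsd, -⟩ := mem_fantope_one_iff.1 hP.1
  obtain ⟨μ, hPu, hu0, hμ⟩ := hlead.exists_rayleigh (isSymm_of_posSemidef hpsd)
  have huu : 0 < u ⬝ᵥ u :=
    lt_of_le_of_ne (dotProduct_self_nonneg' u) fun h0 => hu0 (dotProduct_self_eq_zero.1 h0.symm)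
  set r := (√(u ⬝ᵥ u))⁻¹ with hr
  have hr0 : 0 < r := inv_pos.2 (Real.sqrt_pos.2 huu)
  have hrr : r * r * (u ⬝ᵥ u) = 1 := by
    rw [hr, ← mul_inv, Real.mul_self_sqrt huu.le, inv_mul_cancel₀ huu.ne']
  obtain ⟨π, hπ⟩ : ∃ π : ℤˣ, 0 ≤ ((π : ℤ) : ℝ) * (u ⬝ᵥ v) := by
    rcases le_total 0 (u ⬝ᵥ v) with h0 | h0
    · exact ⟨1, by simpa using h0⟩
    · exact ⟨-1, by simpa using h0⟩
  have hππ : ((π : ℤ) : ℝ) * ((π : ℤ) : ℝ) = 1 := by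
    rcases Int.units_eq_one_or π with rfl | rfl <;> simp
  set w : Fin p → ℝ := (((π : ℤ) : ℝ) * r) • u with hw
  have hww : w ⬝ᵥ w = 1 := by
    rw [hw, smul_dotProduct, dotProduct_smul, smul_eq_mul, smul_eq_mul]
    linear_combination hrr + r * r * (u ⬝ᵥ u) * hππ
  have hPw : P *ᵥ w = μ • w := by rw [hw, mulVec_smul, hPu, smul_comm]
  obtain ⟨hPeq, -, -⟩ := h.eq_vecMulVec_of_isMaxOn hP.1 hP.isMaxOn_penalized hww hPw hμ
  unfold misclustering
  refine (ciInf_le (Set.finite_range _).bddBelow π).trans ?_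
  refine mul_le_mul_of_nonneg_left (Finset.sum_le_sum fun i _ => ?_) (by positivity)
  by_cases hX : X ∈ errorSet lam v z i
  · rw [Set.indicator_of_mem hX]
    split_ifs <;> norm_num
  · rw [Set.indicator_of_notMem hX, if_neg]
    rw [not_not]
    have hpos : 0 < ((z i : ℤ) : ℝ) * (w ⬝ᵥ X i) := by
      by_contra hle
      refine hX ⟨w, hww, hPeq ▸ hP, ?_, not_lt.1 hle⟩
      rw [hw, smul_dotProduct, smul_eq_mul]
      have := mul_nonneg hr0.le hπ
      linarith
    rw [hw, smul_dotProduct, smul_eq_mul] at hpos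
    have hpos' : 0 < ((z i : ℤ) : ℝ) * (((π : ℤ) : ℝ) * (u ⬝ᵥ X i)) := by
      by_contra hle
      have := mul_nonpos_of_nonneg_of_nonpos hr0.le (not_lt.1 hle)
      linarith
    rw [hzhat i, sgn]
    rcases Int.units_eq_one_or π with rfl | rfl <;>
      rcases Int.units_eq_one_or (z i) with hzi | hzi <;> rw [hzi] at hpos' ⊢ <;>
      simp at hpos' ⊢ <;> linarith

lemma matInner_gram_vecMulVec (X : Data n p) (u : Fin p → ℝ) :
    matInner (gram X) (vecMulVec u u) = (1 / (n : ℝ)) * ∑ i, (u ⬝ᵥ X i) ^ 2 := by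
  have h1 : ∀ i, (u ⬝ᵥ X i) ^ 2 = ∑ j, ∑ k, vecMulVec (X i) (X i) j k * (u j * u k) := by
    intro i
    rw [sq, dotProduct, Finset.sum_mul_sum]
    refine Finset.sum_congr rfl fun j _ => Finset.sum_congr rfl fun k _ => ?_
    simp only [vecMulVec_apply]; ring
  simp only [h1, matInner, gram, Matrix.smul_apply, Matrix.sum_apply, vecMulVec_apply, smul_eq_mul]
  rw [Finset.mul_sum]
  simp only [Finset.mul_sum, Finset.sum_mul]
  rw [Finset.sum_comm (s := (Finset.univ : Finset (Fin n)))]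
  refine Finset.sum_congr rfl fun j _ => ?_
  rw [Finset.sum_comm (s := (Finset.univ : Finset (Fin n)))]
  refine Finset.sum_congr rfl fun k _ => Finset.sum_congr rfl fun i _ => ?_
  ring

/-- Cauchy–Schwarz on the support. -/
lemma abs_dotProduct_le_of_supp {S : Finset (Fin p)} {d x : Fin p → ℝ} (hd : ∀ j ∉ S, d j = 0)
    {R : ℝ} (hR : 0 ≤ R) (hx : ∑ j ∈ S, x j ^ 2 ≤ R ^ 2) :
    |d ⬝ᵥ x| ≤ √(d ⬝ᵥ d) * R := by
  have h1 : d ⬝ᵥ x = ∑ j ∈ S, d j * x j :=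
    (Finset.sum_subset (Finset.subset_univ S) fun j _ hj => by rw [hd j hj, zero_mul]).symm
  have h2 : ∑ j ∈ S, d j ^ 2 = d ⬝ᵥ d := by
    rw [dotProduct, ← Finset.sum_subset (Finset.subset_univ S) fun j _ hj => by
      rw [hd j hj, zero_mul]]
    exact Finset.sum_congr rfl fun j _ => sq _
  refine abs_le_of_sq_le_sq ?_ (by positivity)
  rw [h1, mul_pow, Real.sq_sqrt (dotProduct_self_nonneg' d), ← h2]
  exact (Finset.sum_mul_sq_le_sq_mul_sq _ _ _).trans
    (mul_le_mul_of_nonneg_left hx (Finset.sum_nonneg fun _ _ => sq_nonneg _))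

/-- Rank one solutions are supported on `S` and correlate with `v`. -/
lemma NearSpike.of_rankOne_solution {X : Data n p} {lam T e β : ℝ} {S : Finset (Fin p)}
    {v : Fin p → ℝ} (h : NearSpike (gram X) lam S v T e β) {u : Fin p → ℝ} (hu : u ⬝ᵥ u = 1)
    (hP : IsSDPSolution X lam (vecMulVec u u)) (huv : 0 ≤ u ⬝ᵥ v) :
    (∀ j ∉ S, u j = 0) ∧ 1 - β ≤ u ⬝ᵥ v := by
  constructor
  · intro j hj
    have := h.suppOn_of_isMaxOn hP.1 hP.isMaxOn_penalized j j (Or.inl hj)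
    simpa [vecMulVec_apply] using this
  · have h1 := h.one_sub_le_quadForm hP.1 hP.isMaxOn_penalized
    rw [quadForm_vecMulVec] at h1
    have h2 := dotProduct_sq_le u v
    rw [hu, h.unit] at h2
    nlinarith

/-- Stability of the solution under the replacement of one observation. -/
lemma replace_one_stability {X Y : Data n p} {lam T e β R : ℝ} {S : Finset (Fin p)}
    {v : Fin p → ℝ} (hX : NearSpike (gram X) lam S v T e β) (hY : NearSpike (gram Y) lam S v T e β)
    {i : Fin n} (hXY : ∀ k, k ≠ i → X k = Y k) (hR : 0 ≤ R)
    (hXi : ∑ j ∈ S, X i j ^ 2 ≤ R ^ 2) (hYi : ∑ j ∈ S, Y i j ^ 2 ≤ R ^ 2)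
    {u w : Fin p → ℝ} (hu : u ⬝ᵥ u = 1) (hw : w ⬝ᵥ w = 1)
    (hPu : IsSDPSolution X lam (vecMulVec u u)) (hPw : IsSDPSolution Y lam (vecMulVec w w))
    (huv : 0 ≤ u ⬝ᵥ v) (hwv : 0 ≤ w ⬝ᵥ v) :
    |u ⬝ᵥ X i - w ⬝ᵥ X i| ≤ 8 * R ^ 3 / (n * T ^ 2) := by
  obtain ⟨hus, huv'⟩ := hX.of_rankOne_solution hu hPu huv
  obtain ⟨hws, hwv'⟩ := hY.of_rankOne_solution hw hPw hwv
  obtain ⟨d, hd⟩ : ∃ d : Fin p → ℝ, d = (1 / 2 : ℝ) • (u - w) := ⟨_, rfl⟩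
  have hd1 : u - w = (2 : ℝ) • d := by rw [hd, smul_smul]; norm_num
  have hd2 : w - u = (2 : ℝ) • (-d) := by rw [smul_neg, ← hd1]; abel
  have hds : ∀ j ∉ S, d j = 0 := fun j hj => by simp [hd, hus j hj, hws j hj]
  have g1 := hX.quadratic_growth hPu.isMaxOn_penalized hu hw hus hws huv' hwv' hd1
  have g2 := hY.quadratic_growth hPw.isMaxOn_penalized hw hu hws hus hwv' huv' hd2
  rw [neg_dotProduct_neg] at g2
  have hn : (0 : ℝ) < n := by exact_mod_cast Fin.pos i
  have hdiff : ∀ a : Fin p → ℝ, matInner (gram X) (vecMulVec a a) - matInner (gram Y) (vecMulVec a a)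
      = (1 / (n : ℝ)) * ((a ⬝ᵥ X i) ^ 2 - (a ⬝ᵥ Y i) ^ 2) := by
    intro a
    rw [matInner_gram_vecMulVec, matInner_gram_vecMulVec, ← mul_sub, ← Finset.sum_sub_distrib]
    congr 1
    refine Finset.sum_eq_single i (fun k _ hk => ?_) (by simp)
    rw [hXY k hk, sub_self]
  set δ := √(d ⬝ᵥ d) with hδ
  have hδ0 : 0 ≤ δ := Real.sqrt_nonneg _
  have hδ2 : d ⬝ᵥ d = δ ^ 2 := (Real.sq_sqrt (dotProduct_self_nonneg' d)).symm
  have hcross : ∀ x : Fin p → ℝ, ∑ j ∈ S, x j ^ 2 ≤ R ^ 2 →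
      |(u ⬝ᵥ x) ^ 2 - (w ⬝ᵥ x) ^ 2| ≤ 4 * R ^ 2 * δ := by
    intro x hx
    have b1 := abs_dotProduct_le_of_supp hds hR hx
    have b2 := abs_dotProduct_le_of_supp hus hR hx
    have b3 := abs_dotProduct_le_of_supp hws hR hx
    rw [hu, Real.sqrt_one, one_mul] at b2
    rw [hw, Real.sqrt_one, one_mul] at b3
    have b4 : (u ⬝ᵥ x) ^ 2 - (w ⬝ᵥ x) ^ 2 = 2 * (d ⬝ᵥ x) * (u ⬝ᵥ x + w ⬝ᵥ x) := by
      have : u ⬝ᵥ x - w ⬝ᵥ x = 2 * (d ⬝ᵥ x) := by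
        rw [← sub_dotProduct, hd1, smul_dotProduct, smul_eq_mul]
      rw [← this]; ring
    rw [b4, abs_mul, abs_mul, abs_two]
    calc 2 * |d ⬝ᵥ x| * |u ⬝ᵥ x + w ⬝ᵥ x| ≤ 2 * (δ * R) * (R + R) := by
          gcongr
          exact (abs_add_le _ _).trans (add_le_add b2 b3)
      _ = _ := by ring
  have c1 := (abs_le.1 (hcross _ hXi)).2
  have c2 := (abs_le.1 (hcross _ hYi)).1
  have hu' := hdiff u
  have hw' := hdiff w
  unfold penalized at g1 g2
  have hsum : 2 * (T ^ 2 * (d ⬝ᵥ d)) ≤ (1 / (n : ℝ)) * (8 * R ^ 2 * δ) := by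
    have : (1 / (n : ℝ)) * (((u ⬝ᵥ X i) ^ 2 - (w ⬝ᵥ X i) ^ 2) - ((u ⬝ᵥ Y i) ^ 2 - (w ⬝ᵥ Y i) ^ 2))
        ≤ (1 / (n : ℝ)) * (8 * R ^ 2 * δ) := by
      gcongr
      linarith
    linarith
  have hT := hX.T_pos
  have hδle : δ ≤ 4 * R ^ 2 / (n * T ^ 2) := by
    rw [le_div_iff₀ (by positivity)]
    rcases hδ0.eq_or_lt with h0 | h0
    · rw [← h0, zero_mul]; positivity
    · rw [hδ2] at hsum
      have h2 : (2 * (T ^ 2 * δ)) * δ ≤ ((1 / (n : ℝ)) * (8 * R ^ 2)) * δ := by linarith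
      have h3 := le_of_mul_le_mul_right h2 h0
      have h4 : (n : ℝ) * (2 * (T ^ 2 * δ)) ≤ n * ((1 / (n : ℝ)) * (8 * R ^ 2)) := by gcongr
      rw [← mul_assoc (n : ℝ) (1 / (n : ℝ)), mul_one_div_cancel hn.ne', one_mul] at h4
      linarith
  have b1 := abs_dotProduct_le_of_supp hds hR hXi
  rw [← sub_dotProduct, hd1, smul_dotProduct, smul_eq_mul, abs_mul, abs_two]
  calc 2 * |d ⬝ᵥ X i| ≤ 2 * (4 * R ^ 2 / (n * T ^ 2) * R) := by
        gcongr
        exact b1.trans (by gcongr)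
    _ = _ := by ring

end Program

section Moments

/-- Tonelli for products of functions of the separate coordinates. -/
lemma lintegral_pi_prod {n : ℕ} {E : Type*} {mE : MeasurableSpace E}
    {μ : Fin n → Measure E} [∀ i, SigmaFinite (μ i)] {f : Fin n → E → ℝ≥0∞}
    (hf : ∀ i, Measurable (f i)) :
    ∫⁻ x, ∏ i, f i (x i) ∂(Measure.pi μ) = ∏ i, ∫⁻ x, f i x ∂(μ i) := by
  induction n with
  | zero => simp
  | succ n ih =>
    have hmp := (measurePreserving_piFinSuccAbove μ 0).symm
    have hsplit : ∀ q : E × (Fin n → E), ∏ i, f i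
        ((MeasurableEquiv.piFinSuccAbove (fun _ => E) 0).symm q i)
        = f 0 q.1 * ∏ i : Fin n, f i.succ (q.2 i) := by
      intro q
      rw [MeasurableEquiv.piFinSuccAbove_symm_apply, Fin.prod_univ_succ]
      simp [Fin.insertNthEquiv]
    rw [← hmp.lintegral_comp_emb (MeasurableEquiv.measurableEmbedding _)]
    simp_rw [hsplit]
    have hm : Measurable fun y : Fin n → E => ∏ i : Fin n, f i.succ (y i) :=
      Finset.measurable_prod _ fun i _ => (hf (Fin.succ i)).comp (measurable_pi_apply i)
    rw [lintegral_prod_mul (hf 0).aemeasurable hm.aemeasurable, Fin.prod_univ_succ]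
    congr 1
    exact ih fun i => hf i.succ

lemma chernoff {Ω : Type*} {mΩ : MeasurableSpace Ω} {μ : Measure Ω} {h : Ω → ℝ}
    (hm : Measurable h) {a b : ℝ}
    (hb : ∫⁻ x, ENNReal.ofReal (Real.exp (h x)) ∂μ ≤ ENNReal.ofReal (Real.exp b)) :
    μ {x | a ≤ h x} ≤ ENNReal.ofReal (Real.exp (b - a)) := by
  have hpos : 0 < Real.exp a := Real.exp_pos a
  have h1 : {x | a ≤ h x} = {x | ENNReal.ofReal (Real.exp a) ≤ ENNReal.ofReal (Real.exp (h x))} := by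
    ext x
    simp only [Set.mem_ofPred_eq]
    rw [ENNReal.ofReal_le_ofReal_iff (Real.exp_pos _).le, Real.exp_le_exp]
  rw [h1]
  refine (meas_ge_le_lintegral_div ?_ ?_ ENNReal.ofReal_ne_top).trans ?_
  · exact (ENNReal.measurable_ofReal.comp (Real.measurable_exp.comp hm)).aemeasurable
  · simpa using hpos
  · rw [Real.exp_sub, ENNReal.ofReal_div_of_pos hpos]
    gcongr

lemma chernoff_pi {n : ℕ} {Ω : Type*} {mΩ : MeasurableSpace Ω} {μ : Fin n → Measure Ω}
    [∀ i, SigmaFinite (μ i)] {h : Fin n → Ω → ℝ} (hm : ∀ i, Measurable (h i)) {a b : ℝ}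
    (hb : ∀ i, ∫⁻ x, ENNReal.ofReal (Real.exp (h i x)) ∂(μ i) ≤ ENNReal.ofReal (Real.exp b)) :
    Measure.pi μ {x | a ≤ ∑ i, h i (x i)} ≤ ENNReal.ofReal (Real.exp (n * b - a)) := by
  have hsum : Measurable fun x : Fin n → Ω => ∑ i, h i (x i) :=
    Finset.measurable_sum _ fun i _ => (hm i).comp (measurable_pi_apply i)
  refine chernoff hsum ?_
  simp_rw [Real.exp_sum, ENNReal.ofReal_prod_of_nonneg fun _ _ => (Real.exp_pos _).le]
  rw [lintegral_pi_prod (f := fun i x => ENNReal.ofReal (Real.exp (h i x))) fun i =>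
    ENNReal.measurable_ofReal.comp (Real.measurable_exp.comp (hm i))]
  refine (Finset.prod_le_prod' fun i _ => hb i).trans (le_of_eq ?_)
  rw [Finset.prod_const, Finset.card_univ, Fintype.card_fin,
    ← ENNReal.ofReal_pow (Real.exp_pos _).le, ← Real.exp_nat_mul]

lemma lintegral_exp_mul_gaussianReal (m a : ℝ) :
    ∫⁻ x, ENNReal.ofReal (Real.exp (a * x)) ∂(gaussianReal m 1)
      = ENNReal.ofReal (Real.exp (a * m + a ^ 2 / 2)) := by
  rw [← ofReal_integral_eq_lintegral_ofReal (integrable_exp_mul_gaussianReal a)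
    (ae_of_all _ fun _ => (Real.exp_pos _).le)]
  congr 1
  have := congrFun (mgf_fun_id_gaussianReal (μ := m) (v := 1)) a
  rw [mgf] at this
  rw [this]
  congr 1
  simp
  ring

lemma lintegral_exp_mul_sub_gaussianReal (m a : ℝ) :
    ∫⁻ x, ENNReal.ofReal (Real.exp (a * (x - m))) ∂(gaussianReal m 1)
      = ENNReal.ofReal (Real.exp (a ^ 2 / 2)) := by
  have h1 : ∀ x : ℝ, ENNReal.ofReal (Real.exp (a * (x - m)))
      = ENNReal.ofReal (Real.exp (-(a * m))) * ENNReal.ofReal (Real.exp (a * x)) := fun x => by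
    rw [← ENNReal.ofReal_mul (Real.exp_pos _).le, ← Real.exp_add]; ring_nf
  simp_rw [h1]
  rw [lintegral_const_mul _ (by fun_prop), lintegral_exp_mul_gaussianReal,
    ← ENNReal.ofReal_mul (Real.exp_pos _).le, ← Real.exp_add]
  ring_nf

lemma lintegral_exp_sq_gaussianReal (m : ℝ) {t : ℝ} (ht : t < 1 / 2) :
    ∫⁻ x, ENNReal.ofReal (Real.exp (t * (x - m) ^ 2)) ∂(gaussianReal m 1)
      = ENNReal.ofReal (√(1 - 2 * t))⁻¹ := by
  rw [gaussianReal_of_var_ne_zero m one_ne_zero,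
    lintegral_withDensity_eq_lintegral_mul _ (measurable_gaussianPDF m 1) (by fun_prop)]
  have hb : 0 < 1 / 2 - t := by linarith
  have h1 : ∀ x : ℝ, (gaussianPDF m 1 * fun x => ENNReal.ofReal (Real.exp (t * (x - m) ^ 2))) x
      = ENNReal.ofReal ((√(2 * Real.pi))⁻¹ * Real.exp (-(1 / 2 - t) * (x - m) ^ 2)) := fun x => by
    rw [Pi.mul_apply, gaussianPDF, ← ENNReal.ofReal_mul (gaussianPDFReal_nonneg _ _ _),
      gaussianPDFReal, mul_assoc, ← Real.exp_add]
    congr 3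
    · simp
    · simp; ring
  simp_rw [h1]
  rw [lintegral_sub_right_eq_self (fun x : ℝ =>
      ENNReal.ofReal ((√(2 * Real.pi))⁻¹ * Real.exp (-(1 / 2 - t) * x ^ 2))) m,
    ← ofReal_integral_eq_lintegral_ofReal ((integrable_exp_neg_mul_sq hb).const_mul _)
      (ae_of_all _ fun _ => by positivity), integral_const_mul, integral_gaussian]
  congr 1
  rw [← Real.sqrt_inv, ← Real.sqrt_inv, ← Real.sqrt_mul (by positivity)]
  congr 1
  have : 1 - 2 * t ≠ 0 := by linarith
  field_simp

lemma inv_sqrt_one_sub_le_exp {t : ℝ} (h2 : t ≤ 1 / 4) :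
    (√(1 - 2 * t))⁻¹ ≤ Real.exp (t + 2 * t ^ 2) := by
  have key : 1 ≤ (1 - 2 * t) * Real.exp (2 * t + 4 * t ^ 2) := by
    rcases le_total t 0 with h | h
    · have := Real.add_one_le_exp (2 * t + 4 * t ^ 2)
      calc (1 : ℝ) ≤ (1 - 2 * t) * (2 * t + 4 * t ^ 2 + 1) := by nlinarith [sq_nonneg t, mul_nonneg (neg_nonneg.2 h) (sq_nonneg t)]
        _ ≤ _ := by gcongr; linarith
    · have := Real.quadratic_le_exp_of_nonneg (x := 2 * t + 4 * t ^ 2) (by positivity)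
      have h3 : 0 ≤ t ^ 2 := sq_nonneg t
      calc (1 : ℝ) ≤ (1 - 2 * t) * (1 + (2 * t + 4 * t ^ 2) + (2 * t + 4 * t ^ 2) ^ 2 / 2) := by
            have e : (1 - 2 * t) * (1 + (2 * t + 4 * t ^ 2) + (2 * t + 4 * t ^ 2) ^ 2 / 2)
              = 1 + 2 * t ^ 2 * ((1 - 2 * t) * (1 + 2 * t) ^ 2 - 4 * t) := by ring
            have : 0 ≤ (1 - 2 * t) * (1 + 2 * t) ^ 2 - 4 * t := by nlinarith [mul_nonneg h h3]
            rw [e]; nlinarith [mul_nonneg h3 this]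
        _ ≤ _ := by gcongr; linarith
  have hpos : 0 < 1 - 2 * t := by linarith
  have hsq : Real.exp (2 * t + 4 * t ^ 2) = Real.exp (t + 2 * t ^ 2) ^ 2 := by
    rw [← Real.exp_nat_mul]; congr 1; push_cast; ring
  rw [← Real.sqrt_inv]
  refine Real.sqrt_le_iff.2 ⟨(Real.exp_pos _).le, ?_⟩
  rw [← hsq, inv_le_iff_one_le_mul₀ hpos]
  linarith

variable {p : ℕ}

/-- The law `N(m, I_p)`. -/
noncomputable def gaussVec (m : Fin p → ℝ) : Measure (Fin p → ℝ) :=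
  Measure.pi fun j => gaussianReal (m j) 1

instance (m : Fin p → ℝ) : IsProbabilityMeasure (gaussVec m) := by
  unfold gaussVec; infer_instance

lemma gmmLaw_eq {n : ℕ} (θ : EuclideanSpace ℝ (Fin p)) (z : Labels n) :
    gmmLaw θ z = Measure.pi fun i => gaussVec fun j => ((z i : ℤ) : ℝ) * θ j := rfl

instance {n : ℕ} (θ : EuclideanSpace ℝ (Fin p)) (z : Labels n) :
    IsProbabilityMeasure (gmmLaw θ z) := by
  rw [gmmLaw_eq]; infer_instance

lemma lintegral_eval_gaussVec (m : Fin p → ℝ) (k : Fin p) {F : ℝ → ℝ≥0∞} (hF : Measurable F) :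
    ∫⁻ x, F (x k) ∂(gaussVec m) = ∫⁻ y, F y ∂(gaussianReal (m k) 1) :=
  (measurePreserving_eval (fun j => gaussianReal (m j) 1) k).lintegral_comp hF

lemma lintegral_eval_pair_gaussVec (m : Fin p → ℝ) {j k : Fin p} (hjk : j ≠ k)
    {F : ℝ × ℝ → ℝ≥0∞} (hF : Measurable F) :
    ∫⁻ x, F (x j, x k) ∂(gaussVec m)
      = ∫⁻ a, ∫⁻ b, F (a, b) ∂(gaussianReal (m k) 1) ∂(gaussianReal (m j) 1) := by
  have hind : IndepFun (fun x : Fin p → ℝ => x j) (fun x => x k) (gaussVec m) :=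
    (iIndepFun_pi (μ := fun j => gaussianReal (m j) 1) (X := fun _ y => y)
      fun _ => aemeasurable_id).indepFun hjk
  have hmap := (indepFun_iff_map_prod_eq_prod_map_map (measurable_pi_apply j).aemeasurable
    (measurable_pi_apply k).aemeasurable).1 hind
  have hj : (gaussVec m).map (fun x => x j) = gaussianReal (m j) 1 :=
    (measurePreserving_eval (fun j => gaussianReal (m j) 1) j).map_eq
  have hk : (gaussVec m).map (fun x => x k) = gaussianReal (m k) 1 :=
    (measurePreserving_eval (fun j => gaussianReal (m j) 1) k).map_eq
  rw [hj, hk] at hmap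
  rw [← lintegral_prod F hF.aemeasurable, ← hmap, lintegral_map hF (by fun_prop)]

lemma lintegral_exp_dotProduct_gaussVec (m a : Fin p → ℝ) :
    ∫⁻ x, ENNReal.ofReal (Real.exp (a ⬝ᵥ x)) ∂(gaussVec m)
      = ENNReal.ofReal (Real.exp (a ⬝ᵥ m + a ⬝ᵥ a / 2)) := by
  simp_rw [dotProduct, Real.exp_sum, ENNReal.ofReal_prod_of_nonneg fun _ _ => (Real.exp_pos _).le]
  unfold gaussVec
  rw [lintegral_pi_prod (f := fun j x => ENNReal.ofReal (Real.exp (a j * x))) fun i => by fun_prop]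
  simp_rw [lintegral_exp_mul_gaussianReal]
  rw [← ENNReal.ofReal_prod_of_nonneg fun _ _ => (Real.exp_pos _).le, ← Real.exp_sum,
    Finset.sum_add_distrib, Finset.sum_div]
  simp_rw [sq]

/-- The centred products of two noise coordinates are sub-exponential. -/
lemma lintegral_exp_mul_gaussVec_le (m : Fin p → ℝ) (j k : Fin p) {t : ℝ} (ht : |t| ≤ 1 / 4) :
    ∫⁻ x, ENNReal.ofReal (Real.exp
        (t * ((x j - m j) * (x k - m k) - (1 : Matrix (Fin p) (Fin p) ℝ) j k))) ∂(gaussVec m)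
      ≤ ENNReal.ofReal (Real.exp (2 * t ^ 2)) := by
  have ht2 := (abs_le.1 ht).2
  by_cases hjk : j = k
  · subst hjk
    have h1 : ∀ x : Fin p → ℝ, ENNReal.ofReal (Real.exp
        (t * ((x j - m j) * (x j - m j) - (1 : Matrix (Fin p) (Fin p) ℝ) j j)))
        = ENNReal.ofReal (Real.exp (-t)) * ENNReal.ofReal (Real.exp (t * (x j - m j) ^ 2)) := by
      intro x
      rw [← ENNReal.ofReal_mul (Real.exp_pos _).le, ← Real.exp_add, Matrix.one_apply_eq]
      ring_nf
    simp_rw [h1]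
    rw [lintegral_const_mul _ (by fun_prop), lintegral_eval_gaussVec m j
      (F := fun y => ENNReal.ofReal (Real.exp (t * (y - m j) ^ 2))) (by fun_prop),
      lintegral_exp_sq_gaussianReal _ (by linarith), ← ENNReal.ofReal_mul (Real.exp_pos _).le]
    refine ENNReal.ofReal_le_ofReal ?_
    calc Real.exp (-t) * (√(1 - 2 * t))⁻¹ ≤ Real.exp (-t) * Real.exp (t + 2 * t ^ 2) := by
          gcongr; exact inv_sqrt_one_sub_le_exp ht2
      _ = _ := by rw [← Real.exp_add]; ring_nf
  · simp_rw [Matrix.one_apply_ne hjk, sub_zero]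
    rw [lintegral_eval_pair_gaussVec m hjk
      (F := fun q => ENNReal.ofReal (Real.exp (t * ((q.1 - m j) * (q.2 - m k))))) (by fun_prop)]
    simp_rw [← mul_assoc, lintegral_exp_mul_sub_gaussianReal]
    have h1 : ∀ a : ℝ, (t * (a - m j)) ^ 2 / 2 = t ^ 2 / 2 * (a - m j) ^ 2 := fun a => by ring
    have ht3 : t ^ 2 ≤ 1 / 16 := by nlinarith [(abs_le.1 ht).1]
    simp_rw [h1]
    rw [lintegral_exp_sq_gaussianReal _ (by linarith)]
    refine ENNReal.ofReal_le_ofReal ((inv_sqrt_one_sub_le_exp (by linarith)).trans (Real.exp_le_exp.2 ?_))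
    nlinarith [sq_nonneg t]

/-- Upper tail of the squared norm of the noise on a set of coordinates. -/
lemma gaussVec_norm_tail (m : Fin p → ℝ) (S : Finset (Fin p)) (a : ℝ) :
    gaussVec m {x | 4 * S.card + 4 * a ≤ ∑ j ∈ S, (x j - m j) ^ 2}
      ≤ ENNReal.ofReal (Real.exp (-a)) := by
  classical
  have h0 : {x : Fin p → ℝ | 4 * S.card + 4 * a ≤ ∑ j ∈ S, (x j - m j) ^ 2}
      = {x | S.card + a ≤ ∑ j ∈ S, 1 / 4 * (x j - m j) ^ 2} := by
    ext x
    simp only [Set.mem_ofPred_eq, ← Finset.mul_sum]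
    constructor <;> intro h <;> linarith
  rw [h0]
  have hb : ∫⁻ x, ENNReal.ofReal (Real.exp (∑ j ∈ S, 1 / 4 * (x j - m j) ^ 2)) ∂(gaussVec m)
      ≤ ENNReal.ofReal (Real.exp S.card) := by
    have h1 : ∀ x : Fin p → ℝ, ENNReal.ofReal (Real.exp (∑ j ∈ S, 1 / 4 * (x j - m j) ^ 2))
        = ∏ j, ENNReal.ofReal (Real.exp ((if j ∈ S then 1 / 4 else 0) * (x j - m j) ^ 2)) := by
      intro x
      rw [← ENNReal.ofReal_prod_of_nonneg fun _ _ => (Real.exp_pos _).le, ← Real.exp_sum]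
      simp [Finset.sum_ite_mem]
    simp_rw [h1]
    unfold gaussVec
    rw [lintegral_pi_prod (f := fun j x => ENNReal.ofReal
      (Real.exp ((if j ∈ S then 1 / 4 else 0) * (x - m j) ^ 2))) fun i => by fun_prop]
    calc _ ≤ ∏ j : Fin p, ENNReal.ofReal (Real.exp (if j ∈ S then 1 else 0)) := by
          refine Finset.prod_le_prod' fun j _ => ?_
          rw [lintegral_exp_sq_gaussianReal _ (by split_ifs <;> norm_num)]
          refine ENNReal.ofReal_le_ofReal ?_
          refine (inv_sqrt_one_sub_le_exp (by split_ifs <;> norm_num)).trans (Real.exp_le_exp.2 ?_)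
          split_ifs <;> norm_num
      _ = _ := by
          rw [← ENNReal.ofReal_prod_of_nonneg fun _ _ => (Real.exp_pos _).le, ← Real.exp_sum]
          simp
  have := chernoff (a := S.card + a) (by fun_prop) hb
  rwa [sub_add_cancel_left] at this

end Moments

section Concentration

lemma chernoff_pi_abs {n : ℕ} {Ω : Type*} {mΩ : MeasurableSpace Ω} {μ : Fin n → Measure Ω}
    [∀ i, SigmaFinite (μ i)] {g : Fin n → Ω → ℝ} (hm : ∀ i, Measurable (g i)) {t y b : ℝ}
    (ht : 0 < t)
    (hb1 : ∀ i, ∫⁻ x, ENNReal.ofReal (Real.exp (t * g i x)) ∂(μ i) ≤ ENNReal.ofReal (Real.exp b))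
    (hb2 : ∀ i, ∫⁻ x, ENNReal.ofReal (Real.exp (-t * g i x)) ∂(μ i)
      ≤ ENNReal.ofReal (Real.exp b)) :
    Measure.pi μ {x | y < |∑ i, g i (x i)|} ≤ ENNReal.ofReal (2 * Real.exp (n * b - t * y)) := by
  have h1 := chernoff_pi (a := t * y) (fun i => (hm i).const_mul t) hb1
  have h2 := chernoff_pi (a := t * y) (fun i => (hm i).const_mul (-t)) hb2
  have hsub : {x : Fin n → Ω | y < |∑ i, g i (x i)|}
      ⊆ {x | t * y ≤ ∑ i, t * g i (x i)} ∪ {x | t * y ≤ ∑ i, -t * g i (x i)} := by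
    intro x hx
    simp only [Set.mem_union, Set.mem_ofPred_eq, ← Finset.mul_sum] at hx ⊢
    rcases lt_abs.1 hx with h | h
    · exact Or.inl (mul_le_mul_of_nonneg_left h.le ht.le)
    · right
      have := mul_le_mul_of_nonneg_left h.le ht.le
      linarith
  refine (measure_mono hsub).trans ((measure_union_le _ _).trans ((add_le_add h1 h2).trans ?_))
  rw [← ENNReal.ofReal_add (Real.exp_pos _).le (Real.exp_pos _).le, two_mul]

variable {n p : ℕ}

/-- The event that the empirical first and second noise moments are small. -/
def noiseEvent (θ : EuclideanSpace ℝ (Fin p)) (z : Labels n) : Set (Data n p) :=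
  {X | (∀ k, |∑ i, ((z i : ℤ) : ℝ) * (X i k - ((z i : ℤ) : ℝ) * θ k)| ≤ 2 * √(n * Real.log p)) ∧
    ∀ j k, |∑ i, ((X i j - ((z i : ℤ) : ℝ) * θ j) * (X i k - ((z i : ℤ) : ℝ) * θ k)
      - (1 : Matrix (Fin p) (Fin p) ℝ) j k)| ≤ 14 * √(n * Real.log p)}

lemma measurableSet_noiseEvent (θ : EuclideanSpace ℝ (Fin p)) (z : Labels n) :
    MeasurableSet (noiseEvent θ z) := by
  refine IsClosed.measurableSet ?_
  unfold noiseEvent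
  simp only [Set.ofPred_and, Set.ofPred_forall]
  refine IsClosed.inter (isClosed_iInter fun k => ?_)
    (isClosed_iInter fun j => isClosed_iInter fun k => ?_)
  · exact isClosed_le (by fun_prop) continuous_const
  · exact isClosed_le (by fun_prop) continuous_const

lemma sign_mul_self (ε : ℤˣ) : ((ε : ℤ) : ℝ) * ((ε : ℤ) : ℝ) = 1 := by
  rcases Int.units_eq_one_or ε with rfl | rfl <;> simp

lemma abs_gram_sub_le {θ : EuclideanSpace ℝ (Fin p)} {z : Labels n} {X : Data n p}
    (hX : X ∈ noiseEvent θ z) (hn : 0 < n) {κ : ℝ} (hκ : ∀ j, |θ j| ≤ κ) (hκ0 : 0 ≤ κ)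
    (j k : Fin p) :
    |gram X j k - θ j * θ k - (1 : Matrix (Fin p) (Fin p) ℝ) j k|
      ≤ 14 * (1 + κ) * √(Real.log p / n) := by
  obtain ⟨h1, h2⟩ := hX
  have hn' : (0 : ℝ) < n := by exact_mod_cast hn
  have e1 : gram X j k - θ j * θ k - (1 : Matrix (Fin p) (Fin p) ℝ) j k
      = (1 / (n : ℝ)) * (θ j * ∑ i, ((z i : ℤ) : ℝ) * (X i k - ((z i : ℤ) : ℝ) * θ k)
        + θ k * ∑ i, ((z i : ℤ) : ℝ) * (X i j - ((z i : ℤ) : ℝ) * θ j)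
        + ∑ i, ((X i j - ((z i : ℤ) : ℝ) * θ j) * (X i k - ((z i : ℤ) : ℝ) * θ k)
          - (1 : Matrix (Fin p) (Fin p) ℝ) j k)) := by
    have e2 : ∑ i, X i j * X i k = ∑ i, (θ j * θ k + (1 : Matrix (Fin p) (Fin p) ℝ) j k
        + θ j * (((z i : ℤ) : ℝ) * (X i k - ((z i : ℤ) : ℝ) * θ k))
        + θ k * (((z i : ℤ) : ℝ) * (X i j - ((z i : ℤ) : ℝ) * θ j))
        + ((X i j - ((z i : ℤ) : ℝ) * θ j) * (X i k - ((z i : ℤ) : ℝ) * θ k)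
          - (1 : Matrix (Fin p) (Fin p) ℝ) j k)) := by
      refine Finset.sum_congr rfl fun i _ => ?_
      linear_combination (θ j * θ k) * sign_mul_self (z i)
    have e3 : gram X j k = (1 / (n : ℝ)) * ∑ i, X i j * X i k := by
      simp only [gram, Matrix.smul_apply, Matrix.sum_apply, Matrix.vecMulVec_apply, smul_eq_mul]
    rw [e3, e2, Finset.sum_add_distrib, Finset.sum_add_distrib, Finset.sum_add_distrib,
      Finset.sum_const, ← Finset.mul_sum, ← Finset.mul_sum, Finset.card_univ, Fintype.card_fin,
      nsmul_eq_mul]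
    field_simp
    ring
  have hsq : √(Real.log p / n) = (1 / (n : ℝ)) * √(n * Real.log p) := by
    have : Real.log p / n = (1 / (n : ℝ)) ^ 2 * (n * Real.log p) := by field_simp
    rw [this, Real.sqrt_mul (by positivity), Real.sqrt_sq (by positivity)]
  rw [e1, abs_mul, abs_of_nonneg (by positivity : (0 : ℝ) ≤ 1 / n), hsq]
  have hs := Real.sqrt_nonneg (n * Real.log p)
  calc (1 / (n : ℝ)) * |_ + _ + _|
      ≤ (1 / (n : ℝ)) * (κ * (2 * √(n * Real.log p)) + κ * (2 * √(n * Real.log p))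
        + 14 * √(n * Real.log p)) := by
        gcongr
        refine (abs_add_three _ _ _).trans ?_
        rw [abs_mul, abs_mul]
        gcongr
        exacts [hκ j, h1 k, hκ k, h1 j, h2 j k]
    _ ≤ (1 / (n : ℝ)) * (14 * (1 + κ) * √(n * Real.log p)) := by
        gcongr
        nlinarith [mul_nonneg hκ0 hs]
    _ = _ := by ring

lemma gmmLaw_noiseEvent_compl_le (θ : EuclideanSpace ℝ (Fin p)) (z : Labels n) (hn : 0 < n)
    (hp : 2 ≤ p) (hlog : Real.log p ≤ n) :
    gmmLaw θ z (noiseEvent θ z)ᶜ ≤ ENNReal.ofReal (4 / p) := by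
  set L := Real.log p with hL
  have hn' : (0 : ℝ) < n := by exact_mod_cast hn
  have hp' : (0 : ℝ) < p := by positivity
  have hL0 : 0 < L := Real.log_pos (by exact_mod_cast hp)
  have hexp : Real.exp L = p := Real.exp_log hp'
  set q := √(L / n) with hq
  have hq0 : 0 < q := Real.sqrt_pos.2 (by positivity)
  have hq2 : q ^ 2 = L / n := Real.sq_sqrt (by positivity)
  have hq1 : q ≤ 1 := by
    rw [hq]; exact Real.sqrt_le_one.2 ((div_le_one hn').2 hlog)
  have hnq : √(n * L) = n * q := by
    rw [← Real.sqrt_sq (by positivity : 0 ≤ n * q), mul_pow, hq2]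
    congr 1; field_simp
  have hnq2 : n * q ^ 2 = L := by rw [hq2]; field_simp
  have hlin : ∀ k : Fin p, gmmLaw θ z
      {X | 2 * √(n * L) < |∑ i, ((z i : ℤ) : ℝ) * (X i k - ((z i : ℤ) : ℝ) * θ k)|}
      ≤ ENNReal.ofReal (2 * Real.exp (-(2 * L))) := by
    intro k
    have hb : ∀ (i : Fin n) (t : ℝ), ∫⁻ x, ENNReal.ofReal (Real.exp
        (t * (((z i : ℤ) : ℝ) * (x k - ((z i : ℤ) : ℝ) * θ k))))
        ∂(gaussVec fun j => ((z i : ℤ) : ℝ) * θ j) = ENNReal.ofReal (Real.exp (t ^ 2 / 2)) := by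
      intro i t
      simp_rw [← mul_assoc t]
      rw [lintegral_eval_gaussVec _ k (F := fun y => ENNReal.ofReal (Real.exp
        (t * ((z i : ℤ) : ℝ) * (y - ((z i : ℤ) : ℝ) * θ k)))) (by fun_prop),
        lintegral_exp_mul_sub_gaussianReal, mul_pow, sq ((z i : ℤ) : ℝ), sign_mul_self, mul_one]
    have := chernoff_pi_abs (μ := fun i => gaussVec fun j => ((z i : ℤ) : ℝ) * θ j)
      (g := fun i x => ((z i : ℤ) : ℝ) * (x k - ((z i : ℤ) : ℝ) * θ k)) (fun i => by fun_prop)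
      (t := 2 * q) (y := 2 * √(n * L)) (b := (2 * q) ^ 2 / 2) (by positivity)
      (fun i => (hb i _).le) (fun i => by rw [hb i, neg_sq])
    refine this.trans (le_of_eq ?_)
    congr 3
    rw [hnq]
    linear_combination (-2) * hnq2
  have hquad : ∀ j k : Fin p, gmmLaw θ z
      {X | 14 * √(n * L) < |∑ i, ((X i j - ((z i : ℤ) : ℝ) * θ j) *
        (X i k - ((z i : ℤ) : ℝ) * θ k) - (1 : Matrix (Fin p) (Fin p) ℝ) j k)|}
      ≤ ENNReal.ofReal (2 * Real.exp (-(3 * L))) := by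
    intro j k
    have habs : |q / 4| ≤ 1 / 4 := by rw [abs_of_pos (by positivity)]; linarith
    have := chernoff_pi_abs (μ := fun i => gaussVec fun j => ((z i : ℤ) : ℝ) * θ j)
      (g := fun i x => (x j - ((z i : ℤ) : ℝ) * θ j) *
        (x k - ((z i : ℤ) : ℝ) * θ k) - (1 : Matrix (Fin p) (Fin p) ℝ) j k) (fun i => by fun_prop)
      (t := q / 4) (y := 14 * √(n * L)) (b := 2 * (q / 4) ^ 2) (by positivity)
      (fun i => lintegral_exp_mul_gaussVec_le _ j k habs)
      (fun i => by
        rw [← neg_sq (q / 4)]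
        exact lintegral_exp_mul_gaussVec_le _ j k (by rwa [abs_neg]))
    refine this.trans (ENNReal.ofReal_le_ofReal ?_)
    gcongr
    rw [hnq]
    have : n * (2 * (q / 4) ^ 2) - q / 4 * (14 * (n * q)) = -(27 / 8) * L := by
      linear_combination (1 / 8 - 14 / 4) * hnq2
    linarith
  have hsub : (noiseEvent θ z)ᶜ ⊆
      (⋃ k, {X | 2 * √(n * L) < |∑ i, ((z i : ℤ) : ℝ) * (X i k - ((z i : ℤ) : ℝ) * θ k)|}) ∪
      ⋃ j, ⋃ k, {X | 14 * √(n * L) < |∑ i, ((X i j - ((z i : ℤ) : ℝ) * θ j) *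
        (X i k - ((z i : ℤ) : ℝ) * θ k) - (1 : Matrix (Fin p) (Fin p) ℝ) j k)|} := by
    intro X hX
    simp only [Set.mem_union, Set.mem_iUnion, Set.mem_ofPred_eq]
    by_contra! hcon
    exact hX ⟨hcon.1, hcon.2⟩
  have hexp2 : Real.exp (-(2 * L)) = 1 / (p : ℝ) ^ 2 := by
    rw [Real.exp_neg, one_div, ← hexp, ← Real.exp_nat_mul]; norm_num
  have hexp3 : Real.exp (-(3 * L)) = 1 / (p : ℝ) ^ 3 := by
    rw [Real.exp_neg, one_div, ← hexp, ← Real.exp_nat_mul]; norm_num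
  calc gmmLaw θ z (noiseEvent θ z)ᶜ
      ≤ ∑ _k : Fin p, ENNReal.ofReal (2 * Real.exp (-(2 * L)))
        + ∑ _j : Fin p, ∑ _k : Fin p, ENNReal.ofReal (2 * Real.exp (-(3 * L))) := by
        refine (measure_mono hsub).trans ((measure_union_le _ _).trans (add_le_add ?_ ?_))
        · exact (measure_iUnion_fintype_le _ _).trans (Finset.sum_le_sum fun k _ => hlin k)
        · refine (measure_iUnion_fintype_le _ _).trans (Finset.sum_le_sum fun j _ => ?_)
          exact (measure_iUnion_fintype_le _ _).trans (Finset.sum_le_sum fun k _ => hquad j k)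
    _ = ENNReal.ofReal (4 / p) := by
        simp only [Finset.sum_const, Finset.card_univ, Fintype.card_fin, nsmul_eq_mul]
        rw [← ENNReal.ofReal_natCast, ← ENNReal.ofReal_mul (by positivity),
          ← ENNReal.ofReal_mul (by positivity), ← ENNReal.ofReal_mul (by positivity),
          ← ENNReal.ofReal_add (by positivity) (by positivity), hexp2, hexp3]
        congr 1
        field_simp
        norm_num

/-- Disintegration of the law of the data along the `i`-th observation. -/
lemma gmmLaw_apply_slice {N : ℕ} (θ : EuclideanSpace ℝ (Fin p)) (z : Labels (N + 1))
    (i : Fin (N + 1)) {D : Set (Data (N + 1) p)} (hD : MeasurableSet D) :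
    gmmLaw θ z D = ∫⁻ Y : Data N p, gaussVec (fun j => ((z i : ℤ) : ℝ) * θ j)
      {x | (i.insertNth x Y : Data (N + 1) p) ∈ D} ∂(gmmLaw θ fun k => z (i.succAbove k)) := by
  have hmp := (measurePreserving_piFinSuccAbove
    (fun i => gaussVec fun j => ((z i : ℤ) : ℝ) * θ j) i).symm
  rw [gmmLaw_eq, ← hmp.measure_preimage hD.nullMeasurableSet,
    Measure.prod_apply_symm (hmp.measurable hD)]
  rfl

/-- Probability that the `i`-th observation is misclassified. -/
lemma gmmLaw_errorSet_le {θ : EuclideanSpace ℝ (Fin p)} {z : Labels n}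
    {G : Set (Data n p)} (hG : MeasurableSet G) {lam T e β : ℝ} {S : Finset (Fin p)}
    {v : Fin p → ℝ} (hθ : ∀ j, θ j = T * v j)
    (hspike : ∀ X ∈ G, NearSpike (gram X) lam S v T e β) (hT : 0 < T) (hv : v ⬝ᵥ v = 1)
    (i : Fin n) {R : ℝ} (hR0 : 0 ≤ R) (hR : 8 * S.card + 6 * T ^ 2 ≤ R ^ 2) :
    gmmLaw θ z (G ∩ errorSet lam v z i)
      ≤ ENNReal.ofReal (Real.exp (-(T ^ 2 / 2)))
        + ENNReal.ofReal (Real.exp (-(T ^ 2 / 2) + β * T ^ 2 + T * (8 * R ^ 3 / (n * T ^ 2)))) := by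
  obtain ⟨N, rfl⟩ : ∃ N, n = N + 1 := ⟨n - 1, by have := i.pos; omega⟩
  have hmeas := hG.inter (isClosed_errorSet lam v z i).measurableSet
  rw [gmmLaw_apply_slice θ z i hmeas]
  set r := 8 * R ^ 3 / (((N + 1 : ℕ) : ℝ) * T ^ 2) with hr
  set m : Fin p → ℝ := fun j => ((z i : ℤ) : ℝ) * θ j with hm
  suffices hslice : ∀ Y : Data N p,
      gaussVec m {x | (i.insertNth x Y : Data (N + 1) p) ∈ G ∩ errorSet lam v z i}
        ≤ ENNReal.ofReal (Real.exp (-(T ^ 2 / 2)))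
          + ENNReal.ofReal (Real.exp (-(T ^ 2 / 2) + β * T ^ 2 + T * r)) by
    refine (lintegral_mono hslice).trans ?_
    rw [lintegral_const, measure_univ, mul_one]
  intro Y
  have htail : gaussVec m {x | R ^ 2 < ∑ j ∈ S, x j ^ 2} ≤ ENNReal.ofReal (Real.exp (-(T ^ 2 / 2))) := by
    refine (measure_mono fun x hx => ?_).trans (gaussVec_norm_tail m S (T ^ 2 / 2))
    simp only [Set.mem_ofPred_eq] at hx ⊢
    have h1 : ∑ j ∈ S, x j ^ 2 ≤ 2 * ∑ j ∈ S, (x j - m j) ^ 2 + 2 * ∑ j ∈ S, m j ^ 2 := by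
      rw [Finset.mul_sum, Finset.mul_sum, ← Finset.sum_add_distrib]
      exact Finset.sum_le_sum fun j _ => by nlinarith [sq_nonneg (x j - 2 * m j)]
    have h2 : ∑ j ∈ S, m j ^ 2 ≤ T ^ 2 := by
      calc ∑ j ∈ S, m j ^ 2 ≤ ∑ j, m j ^ 2 :=
            Finset.sum_le_sum_of_subset_of_nonneg (Finset.subset_univ S) fun _ _ _ => sq_nonneg _
        _ = T ^ 2 * (v ⬝ᵥ v) := by
            rw [dotProduct, Finset.mul_sum]
            refine Finset.sum_congr rfl fun j _ => ?_
            simp only [hm, hθ j]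
            linear_combination (T * v j) ^ 2 * sign_mul_self (z i)
        _ = T ^ 2 := by rw [hv, mul_one]
    linarith
  set W : Set (Fin p → ℝ) := {x | (i.insertNth x Y : Data (N + 1) p) ∈ G ∩ errorSet lam v z i ∧
    ∑ j ∈ S, x j ^ 2 ≤ R ^ 2} with hW
  have hsub : {x | (i.insertNth x Y : Data (N + 1) p) ∈ G ∩ errorSet lam v z i}
      ⊆ {x | R ^ 2 < ∑ j ∈ S, x j ^ 2} ∪ W := by
    intro x hx
    rcases lt_or_ge (R ^ 2) (∑ j ∈ S, x j ^ 2) with h | h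
    · exact Or.inl h
    · exact Or.inr ⟨hx, h⟩
  refine (measure_mono hsub).trans ((measure_union_le _ _).trans (add_le_add htail ?_))
  rcases W.eq_empty_or_nonempty with hWe | ⟨x₀, ⟨hx₀G, hx₀E⟩, hx₀R⟩
  · rw [hWe, measure_empty]; exact zero_le
  obtain ⟨w, hw, hPw, hwv, -⟩ := hx₀E
  have hW' : W ⊆ {x | -(T * r) ≤ (-(T * ((z i : ℤ) : ℝ)) • w) ⬝ᵥ x} := by
    rintro x ⟨⟨hxG, u, hu, hPu, huv, hux⟩, hxR⟩
    have hstab := replace_one_stability (hspike _ hxG) (hspike _ hx₀G) (i := i) (R := R)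
      (fun k hk => by
        obtain ⟨k', rfl⟩ := Fin.exists_succAbove_eq hk
        rw [Fin.insertNth_apply_succAbove, Fin.insertNth_apply_succAbove]) hR0
      (by rw [Fin.insertNth_apply_same]; exact hxR)
      (by rw [Fin.insertNth_apply_same]; exact hx₀R) hu hw hPu hPw huv hwv
    rw [Fin.insertNth_apply_same, ← hr] at hstab
    rw [Fin.insertNth_apply_same] at hux
    simp only [Set.mem_ofPred_eq, smul_dotProduct, smul_eq_mul]
    have h1 : ((z i : ℤ) : ℝ) * (w ⬝ᵥ x) ≤ r := by
      obtain ⟨h2, h3⟩ := abs_le.1 hstab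
      rcases Int.units_eq_one_or (z i) with hz | hz <;> rw [hz] at hux ⊢ <;>
        simp only [Units.val_one, Units.val_neg, Int.cast_one, Int.cast_neg, one_mul, neg_mul]
          at hux ⊢ <;> linarith
    have h2 := mul_le_mul_of_nonneg_left h1 hT.le
    linarith
  refine (measure_mono hW').trans ?_
  have hwv' := ((hspike _ hx₀G).of_rankOne_solution hw hPw hwv).2
  have hint : ∫⁻ x, ENNReal.ofReal (Real.exp ((-(T * ((z i : ℤ) : ℝ)) • w) ⬝ᵥ x)) ∂(gaussVec m)
      ≤ ENNReal.ofReal (Real.exp (-(T ^ 2 / 2) + β * T ^ 2)) := by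
    rw [lintegral_exp_dotProduct_gaussVec]
    refine ENNReal.ofReal_le_ofReal (Real.exp_le_exp.2 ?_)
    have h1 : (-(T * ((z i : ℤ) : ℝ)) • w) ⬝ᵥ m = -(T ^ 2 * (w ⬝ᵥ v)) := by
      have : m = (((z i : ℤ) : ℝ) * T) • v := by
        ext j; simp only [hm, hθ j, Pi.smul_apply, smul_eq_mul]; ring
      rw [this, smul_dotProduct, dotProduct_smul, smul_eq_mul, smul_eq_mul]
      linear_combination (-(T ^ 2 * (w ⬝ᵥ v))) * sign_mul_self (z i)
    have h2 : (-(T * ((z i : ℤ) : ℝ)) • w) ⬝ᵥ (-(T * ((z i : ℤ) : ℝ)) • w) = T ^ 2 := by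
      rw [smul_dotProduct, dotProduct_smul, hw, smul_eq_mul, smul_eq_mul]
      linear_combination T ^ 2 * sign_mul_self (z i)
    rw [h1, h2]
    nlinarith [sq_nonneg T]
  have := chernoff (a := -(T * r)) (by fun_prop) hint
  rwa [sub_neg_eq_add] at this

end Concentration

section UpperBound

variable {n p : ℕ}

/-- If each error set has small probability on the good event, then on a measurable set of large
probability the fraction of errors is small. -/
lemma markov_errorSet {θ : EuclideanSpace ℝ (Fin p)} {z : Labels n} {G : Set (Data n p)}
    (hG : MeasurableSet G) {lam : ℝ} {v : Fin p → ℝ} {ε W : ℝ} (hn : 0 < n) (hW : 0 < W)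
    (hprob : ∀ i, gmmLaw θ z (G ∩ errorSet lam v z i) ≤ ENNReal.ofReal ε) :
    gmmLaw θ z (G ∩ {X | ¬ (1 / (n : ℝ)) * ∑ i, (errorSet lam v z i).indicator
      (fun _ => (1 : ℝ)) X ≤ W}) ≤ ENNReal.ofReal (ε / W) := by
  have hn' : (0 : ℝ) < n := by exact_mod_cast hn
  have hmeas : ∀ i, MeasurableSet (G ∩ errorSet lam v z i) :=
    fun i => hG.inter (isClosed_errorSet lam v z i).measurableSet
  have hsub : G ∩ {X | ¬ (1 / (n : ℝ)) * ∑ i, (errorSet lam v z i).indicator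
      (fun _ => (1 : ℝ)) X ≤ W} ⊆ {X | ENNReal.ofReal (n * W)
        ≤ ∑ i, (G ∩ errorSet lam v z i).indicator (fun _ => (1 : ℝ≥0∞)) X} := by
    rintro X ⟨hXG, hX⟩
    simp only [Set.mem_ofPred_eq, not_le] at hX ⊢
    have h1 : n * W ≤ ∑ i, (errorSet lam v z i).indicator (fun _ => (1 : ℝ)) X := by
      have := mul_le_mul_of_nonneg_left hX.le hn'.le
      rwa [← mul_assoc, mul_one_div_cancel hn'.ne', one_mul] at this
    refine (ENNReal.ofReal_le_ofReal h1).trans (le_of_eq ?_)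
    rw [ENNReal.ofReal_sum_of_nonneg fun i _ => Set.indicator_nonneg (fun _ _ => zero_le_one) _]
    refine Finset.sum_congr rfl fun i _ => ?_
    by_cases hXi : X ∈ errorSet lam v z i
    · rw [Set.indicator_of_mem hXi, Set.indicator_of_mem (Set.mem_inter hXG hXi), ENNReal.ofReal_one]
    · rw [Set.indicator_of_notMem hXi, Set.indicator_of_notMem fun h => hXi h.2, ENNReal.ofReal_zero]
  have hint : ∫⁻ X, ∑ i, (G ∩ errorSet lam v z i).indicator (fun _ => (1 : ℝ≥0∞)) X ∂(gmmLaw θ z)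
      ≤ ENNReal.ofReal (n * ε) := by
    rw [lintegral_finsetSum _ fun i _ => measurable_const.indicator (hmeas i)]
    calc _ ≤ ∑ _i : Fin n, ENNReal.ofReal ε := by
          refine Finset.sum_le_sum fun i _ => ?_
          rw [lintegral_indicator (hmeas i), lintegral_one, Measure.restrict_apply_univ]
          exact hprob i
      _ = _ := by
          rw [Finset.sum_const, Finset.card_univ, Fintype.card_fin, nsmul_eq_mul,
            ← ENNReal.ofReal_natCast, ← ENNReal.ofReal_mul hn'.le]
  refine (measure_mono hsub).trans ((meas_ge_le_lintegral_div ?_ ?_ ENNReal.ofReal_ne_top).trans ?_)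
  · exact (Finset.measurable_sum _ fun i _ => measurable_const.indicator (hmeas i)).aemeasurable
  · exact (ENNReal.ofReal_pos.2 (mul_pos hn' hW)).ne'
  · have h2 : ε / W = (n * ε) / (n * W) := by field_simp
    rw [h2, ENNReal.ofReal_div_of_pos (mul_pos hn' hW)]
    gcongr

/-- The deviation caused by replacing one observation is of lower order. -/
lemma replacement_error_le {N L s T κ τ R : ℝ} (hN : 0 < N) (hL : 1 ≤ L)
    (hs : 0 < s) (hT : 0 < T) (hκL : κ ^ 2 ≤ L) (hTs : T ^ 2 ≤ s * κ ^ 2) (hτ0 : 0 ≤ τ)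
    (hτ : τ ^ 2 = s ^ 2 * L * (1 + κ ^ 2) / (N * T ^ 4)) (hτ1 : τ ^ 2 ≤ 1)
    (hR : R ^ 2 ≤ 8 * s + 6 * T ^ 2) :
    T * (8 * R ^ 3 / (N * T ^ 2)) ≤ 432 * τ * T ^ 2 := by
  set g := 1 + κ ^ 2 with hg
  have hg1 : 1 ≤ g := by rw [hg]; nlinarith [sq_nonneg κ]
  have hτ' : τ ^ 2 * (N * T ^ 4) = s ^ 2 * L * g := by rw [hτ]; field_simp
  have hR2 : R ^ 2 ≤ 9 * s * g := by rw [hg]; nlinarith [mul_nonneg hs.le (sq_nonneg κ)]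
  have h1 : s ^ 2 * L * g ≤ N * T ^ 2 * (s * κ ^ 2) := by
    rw [← hτ']
    calc τ ^ 2 * (N * T ^ 4) ≤ 1 * (N * T ^ 4) := by gcongr
      _ = N * T ^ 2 * T ^ 2 := by ring
      _ ≤ _ := by gcongr
  have h2 : s * L * g ≤ N * T ^ 2 * κ ^ 2 := by
    refine le_of_mul_le_mul_left ?_ hs
    linarith
  have h3 : s * g ^ 2 ≤ 2 * (N * L * T ^ 2) := by
    have hL0 : 0 < L := by linarith
    refine le_of_mul_le_mul_left ?_ hL0
    calc L * (s * g ^ 2) = s * L * g * g := by ring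
      _ ≤ N * T ^ 2 * κ ^ 2 * g := by gcongr
      _ ≤ N * T ^ 2 * L * (2 * L) := by gcongr; rw [hg]; linarith
      _ = _ := by ring
  have h4 : (R ^ 3) ^ 2 ≤ (54 * (N * τ * T ^ 3)) ^ 2 := by
    calc (R ^ 3) ^ 2 = (R ^ 2) ^ 3 := by ring
      _ ≤ (9 * s * g) ^ 3 := by gcongr
      _ = 729 * (s ^ 2 * g) * (s * g ^ 2) := by ring
      _ ≤ 729 * (s ^ 2 * g) * (2 * (N * L * T ^ 2)) := by gcongr
      _ = 1458 * (N * T ^ 2) * (s ^ 2 * L * g) := by ring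
      _ = 1458 * (N * τ * T ^ 3) ^ 2 := by rw [← hτ']; ring
      _ ≤ (54 * (N * τ * T ^ 3)) ^ 2 := by nlinarith [sq_nonneg (N * τ * T ^ 3)]
  have h5 : R ^ 3 ≤ 54 * (N * τ * T ^ 3) := le_of_abs_le (abs_le_of_sq_le_sq h4 (by positivity))
  calc T * (8 * R ^ 3 / (N * T ^ 2)) ≤ T * (8 * (54 * (N * τ * T ^ 3)) / (N * T ^ 2)) := by gcongr
    _ = _ := by field_simp; ring

theorem sparse_spectral_upper_bound {C : ℝ} (hC : 14 ≤ C) {s : ℕ} {θ : EuclideanSpace ℝ (Fin p)}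
    {z : Labels n} {κ lam τ : ℝ} (hθ : θ ≠ 0) (hs : l0norm θ ≤ s) (hlog : Real.log p ≤ n)
    (hκ0 : 0 < κ) (hκ : ∀ j, |θ j| ≤ κ) (hκL : κ ≤ √(Real.log p))
    (hlam : lam = C * (1 + κ) * √(Real.log p / n)) (hτ0 : 0 ≤ τ)
    (hτ : τ ^ 2 = (s : ℝ) ^ 2 * Real.log p * (1 + κ ^ 2) / (n * ‖θ‖ ^ 4))
    (hτc : τ ^ 2 ≤ (1 / (32 * C)) ^ 2) :
    ∃ A : Set (Data n p), MeasurableSet A ∧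
      ENNReal.ofReal (1 - 8 / (p : ℝ) - 2 * Real.exp (-‖θ‖ / 2)) ≤ gmmLaw θ z A ∧
      ∀ X ∈ A, (∃ zhat, IsSparseSpectralOutput X lam zhat) ∧
        ∀ zhat, IsSparseSpectralOutput X lam zhat →
          misclustering zhat z
            ≤ 2 * Real.exp (-(‖θ‖ ^ 2 / 2 * (1 - (8 * C + 864) * τ - ‖θ‖⁻¹))) := by
  have hp0 : 0 < p := by
    rcases Nat.eq_zero_or_pos p with rfl | h
    · exact absurd (Subsingleton.elim θ 0) hθ
    · exact h
  have hp' : (0 : ℝ) < p := by exact_mod_cast hp0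
  rcases Nat.lt_or_ge p 8 with hp8 | hp8
  · refine ⟨∅, MeasurableSet.empty, ?_, fun X hX => absurd hX (Set.notMem_empty X)⟩
    have h1 : (1 : ℝ) ≤ 8 / p := by
      rw [one_le_div hp']; exact_mod_cast hp8.le
    rw [ENNReal.ofReal_of_nonpos (by linarith [Real.exp_pos (-‖θ‖ / 2)])]
    exact zero_le
  set T := ‖θ‖ with hTdef
  set L := Real.log p with hL
  have hT : 0 < T := norm_pos_iff.2 hθ
  have hL1 : 1 ≤ L := by
    rw [hL, Real.le_log_iff_exp_le hp']
    have : (8 : ℝ) ≤ p := by exact_mod_cast hp8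
    linarith [Real.exp_one_lt_d9]
  have hn' : (0 : ℝ) < n := by linarith
  have hn : 0 < n := by exact_mod_cast hn'
  classical
  set S : Finset (Fin p) := Finset.univ.filter fun j => θ j ≠ 0 with hS
  have hScard : S.card ≤ s := by
    refine le_trans (le_of_eq ?_) hs
    rw [l0norm, Set.ncard_eq_toFinset_card']
    congr 1
    ext j; simp [hS]
  have hScard' : (S.card : ℝ) ≤ s := by exact_mod_cast hScard
  have hnorm : T ^ 2 = ∑ j, θ j ^ 2 := by
    rw [hTdef, EuclideanSpace.norm_sq_eq]
    simp
  have hTs : T ^ 2 ≤ s * κ ^ 2 := by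
    have h1 : ∑ j, θ j ^ 2 = ∑ j ∈ S, θ j ^ 2 :=
      (Finset.sum_subset (Finset.subset_univ S) fun j _ hj => by
        have : θ j = 0 := by simpa [hS] using hj
        rw [this]; ring).symm
    rw [hnorm, h1]
    calc ∑ j ∈ S, θ j ^ 2 ≤ ∑ _j ∈ S, κ ^ 2 :=
          Finset.sum_le_sum fun j _ => sq_le_sq' (abs_le.1 (hκ j)).1 (abs_le.1 (hκ j)).2
      _ = S.card * κ ^ 2 := by rw [Finset.sum_const, nsmul_eq_mul]
      _ ≤ s * κ ^ 2 := by gcongr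
  have hs0 : (0 : ℝ) < s := by
    by_contra h
    have : (s : ℝ) * κ ^ 2 ≤ 0 := mul_nonpos_of_nonpos_of_nonneg (not_lt.1 h) (sq_nonneg κ)
    nlinarith [pow_pos hT 2]
  have hκ2 : κ ^ 2 ≤ L := by
    have := Real.sq_sqrt (by linarith : (0 : ℝ) ≤ L)
    rw [← this]
    gcongr
  have hC0 : 0 < C := by linarith
  have hτ1 : τ ≤ 1 / (32 * C) := le_of_abs_le (abs_le_of_sq_le_sq hτc (by positivity))
  have hτle1 : τ ^ 2 ≤ 1 := by
    have : 1 / (32 * C) ≤ 1 := by rw [div_le_one (by positivity)]; linarith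
    nlinarith
  set v : Fin p → ℝ := fun j => θ j / T with hv
  have hθv : ∀ j, θ j = T * v j := fun j => by simp only [hv]; field_simp
  have hvv : v ⬝ᵥ v = 1 := by
    have h1 : T ^ 2 * (v ⬝ᵥ v) = T ^ 2 * 1 := by
      rw [mul_one]
      conv_rhs => rw [hnorm]
      rw [dotProduct, Finset.mul_sum]
      exact Finset.sum_congr rfl fun j _ => by rw [hθv j]; ring
    exact mul_left_cancel₀ (pow_pos hT 2).ne' h1
  set q := √(L / n) with hq
  have hq0 : 0 ≤ q := Real.sqrt_nonneg _
  have hq2 : q ^ 2 = L / n := Real.sq_sqrt (by positivity)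
  have hsq : s * q * (1 + κ) ≤ 2 * (τ * T ^ 2) := by
    refine le_of_abs_le (abs_le_of_sq_le_sq ?_ (by positivity))
    have h1 : (τ * T ^ 2) ^ 2 = s ^ 2 * (L / n) * (1 + κ ^ 2) := by
      rw [mul_pow, hτ]; field_simp
    have h2 : (s * q * (1 + κ)) ^ 2 = s ^ 2 * (L / n) * (1 + κ) ^ 2 := by rw [← hq2]; ring
    have h3 : (0 : ℝ) ≤ s ^ 2 * (L / n) := by positivity
    rw [h2, mul_pow 2, h1]
    nlinarith [sq_nonneg (κ - 1), mul_nonneg h3 (sq_nonneg (κ - 1)), mul_nonneg h3 (sq_nonneg κ)]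
  set G := noiseEvent θ z with hGdef
  have hG : MeasurableSet G := measurableSet_noiseEvent θ z
  have hspike : ∀ X ∈ G, NearSpike (gram X) lam S v T (14 * (1 + κ) * q) (4 * C * τ) := by
    intro X hX
    refine ⟨fun j k => ?_, by positivity, ?_, hvv, fun j hj => ?_, hT, ?_, ?_⟩
    · have := abs_gram_sub_le hX hn hκ hκ0.le j k
      rwa [hθv j, hθv k] at this
    · rw [hlam]; gcongr
    · have : θ j = 0 := by simpa [hS] using hj
      simp [hv, this]
    · rw [hlam]
      calc 2 * (C * (1 + κ) * q) * S.card ≤ 2 * (C * (1 + κ) * q) * s := by gcongr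
        _ = 2 * C * (s * q * (1 + κ)) := by ring
        _ ≤ 2 * C * (2 * (τ * T ^ 2)) := by gcongr
        _ = _ := by ring
    · calc 4 * C * τ ≤ 4 * C * (1 / (32 * C)) := by gcongr
        _ = 1 / 8 := by field_simp; norm_num
  set E := Real.exp (-(T ^ 2 / 2 * (1 - (8 * C + 864) * τ))) with hE
  have hprob : ∀ i, gmmLaw θ z (G ∩ errorSet lam v z i) ≤ ENNReal.ofReal (2 * E) := by
    intro i
    set R := √(8 * S.card + 6 * T ^ 2) with hR
    have hR2 : R ^ 2 = 8 * S.card + 6 * T ^ 2 := Real.sq_sqrt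
      (add_nonneg (mul_nonneg (by norm_num) (Nat.cast_nonneg _)) (by positivity))
    refine (gmmLaw_errorSet_le hG hθv hspike hT hvv i (Real.sqrt_nonneg _) hR2.ge).trans ?_
    have hrep := replacement_error_le hn' hL1 hs0 hT hκ2 hTs hτ0 hτ hτle1
      (hR2.le.trans (by linarith))
    rw [← ENNReal.ofReal_add (Real.exp_pos _).le (Real.exp_pos _).le, two_mul]
    have hTτ : 0 ≤ T ^ 2 * τ := by positivity
    refine ENNReal.ofReal_le_ofReal (add_le_add (Real.exp_le_exp.2 ?_) (Real.exp_le_exp.2 ?_))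
    · nlinarith [mul_nonneg hC0.le hTτ]
    · linarith
  set W := 2 * Real.exp (-(T ^ 2 / 2 * (1 - (8 * C + 864) * τ - T⁻¹))) with hW
  have hW0 : 0 < W := by positivity
  have hratio : 2 * E / W = Real.exp (-T / 2) := by
    rw [hE, hW, mul_div_mul_left _ _ two_ne_zero, ← Real.exp_sub]
    congr 1
    field_simp
    ring
  have hmarkov := markov_errorSet hG hn hW0 hprob
  rw [hratio] at hmarkov
  set B := {X : Data n p | (1 / (n : ℝ)) * ∑ i, (errorSet lam v z i).indicator
    (fun _ => (1 : ℝ)) X ≤ W} with hB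
  have hBm : MeasurableSet B := by
    refine measurableSet_le (Measurable.const_mul (Finset.measurable_sum _ fun i _ => ?_) _)
      measurable_const
    exact measurable_const.indicator (isClosed_errorSet lam v z i).measurableSet
  refine ⟨G ∩ B, hG.inter hBm, ?_, fun X hX => ⟨exists_isSparseSpectralOutput hp0 X lam,
    fun zhat hz => (misclustering_le_of_output (hspike X hX.1) hz).trans hX.2⟩⟩
  have hcompl : gmmLaw θ z (G ∩ B)ᶜ
      ≤ ENNReal.ofReal (8 / (p : ℝ) + 2 * Real.exp (-T / 2)) := by
    have hsub : (G ∩ B)ᶜ ⊆ Gᶜ ∪ (G ∩ Bᶜ) := by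
      intro X hX
      by_cases h : X ∈ G
      · exact Or.inr ⟨h, fun hXB => hX ⟨h, hXB⟩⟩
      · exact Or.inl h
    refine (measure_mono hsub).trans ((measure_union_le _ _).trans ((add_le_add
      (gmmLaw_noiseEvent_compl_le θ z hn (by omega) hlog) hmarkov).trans ?_))
    rw [← ENNReal.ofReal_add (by positivity) (by positivity)]
    refine ENNReal.ofReal_le_ofReal (add_le_add ?_ ?_)
    · gcongr; norm_num
    · linarith [Real.exp_pos (-T / 2)]
  have h1 : gmmLaw θ z (G ∩ B) = 1 - gmmLaw θ z (G ∩ B)ᶜ := by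
    rw [prob_compl_eq_one_sub (hG.inter hBm), ENNReal.sub_sub_cancel ENNReal.one_ne_top prob_le_one]
  rw [h1, sub_sub, ENNReal.ofReal_sub _ (by positivity), ENNReal.ofReal_one]
  exact tsub_le_tsub_left hcompl 1

end UpperBound

section LowerBound

variable {n p : ℕ}

instance : MeasurableSingletonClass ℤˣ := by
  refine ⟨fun ε => ?_⟩
  have : ({ε} : Set ℤˣ) = Units.val ⁻¹' {(ε : ℤ)} := by
    ext x; simp [Units.ext_iff]
  rw [this]
  exact measurableSet_preimage (comap_measurable _) (measurableSet_singleton _)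

lemma gaussianReal_eq_withDensity (a : ℝ) :
    gaussianReal a 1
      = (gaussianReal 0 1).withDensity fun x => ENNReal.ofReal (Real.exp (a * x - a ^ 2 / 2)) := by
  rw [gaussianReal_of_var_ne_zero a one_ne_zero, gaussianReal_of_var_ne_zero 0 one_ne_zero,
    ← withDensity_mul _ (measurable_gaussianPDF 0 1) (by fun_prop)]
  congr 1
  ext x
  rw [Pi.mul_apply, gaussianPDF, gaussianPDF, ← ENNReal.ofReal_mul (gaussianPDFReal_nonneg _ _ _),
    gaussianPDFReal, gaussianPDFReal]
  conv_rhs => rw [mul_assoc, ← Real.exp_add]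
  congr 3
  simp
  ring

lemma gaussVec_eq_withDensity (a : Fin p → ℝ) :
    gaussVec a
      = (gaussVec 0).withDensity fun x => ENNReal.ofReal (Real.exp (a ⬝ᵥ x - a ⬝ᵥ a / 2)) := by
  refine Measure.pi_eq fun s hs => ?_
  rw [withDensity_apply _ (MeasurableSet.univ_pi hs), ← lintegral_indicator (MeasurableSet.univ_pi hs)]
  have h1 : ∀ x : Fin p → ℝ, (Set.univ.pi s).indicator
      (fun x => ENNReal.ofReal (Real.exp (a ⬝ᵥ x - a ⬝ᵥ a / 2))) x
      = ∏ j, (s j).indicator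
        (fun y => ENNReal.ofReal (Real.exp (a j * y - a j ^ 2 / 2))) (x j) := by
    intro x
    by_cases hx : x ∈ Set.univ.pi s
    · rw [Set.indicator_of_mem hx]
      have : a ⬝ᵥ x - a ⬝ᵥ a / 2 = ∑ j, (a j * x j - a j ^ 2 / 2) := by
        simp only [dotProduct, Finset.sum_sub_distrib, Finset.sum_div, sq]
      rw [this, Real.exp_sum, ENNReal.ofReal_prod_of_nonneg fun _ _ => (Real.exp_pos _).le]
      exact Finset.prod_congr rfl fun j _ => by rw [Set.indicator_of_mem (hx j (Set.mem_univ j))]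
    · rw [Set.indicator_of_notMem hx]
      obtain ⟨j, hj⟩ : ∃ j, x j ∉ s j := by simpa [Set.mem_univ_pi] using hx
      exact (Finset.prod_eq_zero (Finset.mem_univ j) (Set.indicator_of_notMem hj _)).symm
  simp_rw [h1]
  unfold gaussVec
  rw [lintegral_pi_prod (f := fun j => (s j).indicator
      (fun y => ENNReal.ofReal (Real.exp (a j * y - a j ^ 2 / 2))))
    fun j => (Measurable.indicator (by fun_prop) (hs j))]
  refine Finset.prod_congr rfl fun j _ => ?_
  rw [gaussianReal_eq_withDensity (a j), withDensity_apply _ (hs j), lintegral_indicator (hs j)]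
  rfl

/-- Change of measure on the slab `{|a ⬝ x| ≤ 2 Δ}`. -/
lemma mul_gaussVec_zero_le {a : Fin p → ℝ} {Δ : ℝ} (ha : a ⬝ᵥ a = Δ ^ 2) {B : Set (Fin p → ℝ)}
    (hB : MeasurableSet B) (hslab : ∀ x ∈ B, -(2 * Δ) ≤ a ⬝ᵥ x) :
    ENNReal.ofReal (Real.exp (-(Δ ^ 2 / 2) - 2 * Δ)) * gaussVec 0 B ≤ gaussVec a B := by
  rw [gaussVec_eq_withDensity a, withDensity_apply _ hB, ← setLIntegral_const]
  refine setLIntegral_mono' hB fun x hx => ENNReal.ofReal_le_ofReal (Real.exp_le_exp.2 ?_)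
  rw [ha]
  linarith [hslab x hx]

lemma half_le_gaussVec_slab {a : Fin p → ℝ} {Δ : ℝ} (hΔ : 0 < Δ) (ha : a ⬝ᵥ a = Δ ^ 2) :
    ENNReal.ofReal (1 / 2) ≤ gaussVec 0 {x | |a ⬝ᵥ x| ≤ 2 * Δ} := by
  have hm : MeasurableSet {x : Fin p → ℝ | |a ⬝ᵥ x| ≤ 2 * Δ} :=
    (isClosed_le (by fun_prop) continuous_const).measurableSet
  have htail : ∀ c : ℝ, c ^ 2 = (2 / Δ) ^ 2 →
      gaussVec 0 {x : Fin p → ℝ | 4 ≤ (c • a) ⬝ᵥ x} ≤ ENNReal.ofReal (1 / 4) := by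
    intro c hc
    have hb : ∫⁻ x, ENNReal.ofReal (Real.exp ((c • a) ⬝ᵥ x)) ∂(gaussVec (0 : Fin p → ℝ))
        ≤ ENNReal.ofReal (Real.exp 2) := by
      rw [lintegral_exp_dotProduct_gaussVec, dotProduct_zero, smul_dotProduct, dotProduct_smul, ha]
      refine ENNReal.ofReal_le_ofReal (Real.exp_le_exp.2 (le_of_eq ?_))
      rw [smul_eq_mul, smul_eq_mul, ← mul_assoc, ← sq, hc]
      field_simp
      norm_num
    refine (chernoff (a := 4) (by fun_prop) hb).trans (ENNReal.ofReal_le_ofReal ?_)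
    have h2 : (2 : ℝ) ≤ Real.exp 1 := by linarith [Real.add_one_le_exp (1 : ℝ)]
    have h4 : (4 : ℝ) ≤ Real.exp 2 := by
      have : Real.exp 2 = Real.exp 1 * Real.exp 1 := by rw [← Real.exp_add]; norm_num
      rw [this]; nlinarith
    rw [show (2 : ℝ) - 4 = -2 by norm_num, Real.exp_neg, one_div]
    exact inv_anti₀ (by norm_num) h4
  have hcompl : gaussVec 0 {x | |a ⬝ᵥ x| ≤ 2 * Δ}ᶜ ≤ ENNReal.ofReal (1 / 2) := by
    have hsub : {x : Fin p → ℝ | |a ⬝ᵥ x| ≤ 2 * Δ}ᶜ ⊆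
        {x | 4 ≤ ((2 / Δ) • a) ⬝ᵥ x} ∪ {x | 4 ≤ ((-(2 / Δ)) • a) ⬝ᵥ x} := by
      intro x hx
      simp only [Set.mem_compl_iff, Set.mem_ofPred_eq, not_le, Set.mem_union, smul_dotProduct,
        smul_eq_mul] at hx ⊢
      have h4 : 2 / Δ * (2 * Δ) = 4 := by field_simp; norm_num
      rcases lt_abs.1 hx with h | h
      · exact Or.inl (by rw [← h4]; gcongr)
      · right
        have := mul_le_mul_of_nonneg_left h.le (by positivity : 0 ≤ 2 / Δ)
        linarith
    refine (measure_mono hsub).trans ((measure_union_le _ _).trans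
      ((add_le_add (htail _ rfl) (htail _ (neg_sq _))).trans ?_))
    rw [← ENNReal.ofReal_add (by norm_num) (by norm_num)]
    norm_num
  have h1 := prob_add_prob_compl (μ := gaussVec (0 : Fin p → ℝ)) hm
  by_contra! hlt
  have h2 : gaussVec (0 : Fin p → ℝ) {x | |a ⬝ᵥ x| ≤ 2 * Δ}
      + gaussVec 0 {x | |a ⬝ᵥ x| ≤ 2 * Δ}ᶜ < 1 := by
    calc _ < ENNReal.ofReal (1 / 2) + ENNReal.ofReal (1 / 2) :=
          ENNReal.add_lt_add_of_lt_of_le (measure_ne_top _ _) hlt hcompl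
      _ = 1 := by rw [← ENNReal.ofReal_add (by norm_num) (by norm_num)]; norm_num
  exact h2.ne h1

/-- The sum of the two error probabilities of a test between `N(a, I)` and `N(-a, I)`. -/
lemma two_point_gaussVec {a : Fin p → ℝ} {Δ : ℝ} (hΔ : 0 < Δ) (ha : a ⬝ᵥ a = Δ ^ 2)
    {D : Set (Fin p → ℝ)} (hD : MeasurableSet D) :
    ENNReal.ofReal (Real.exp (-(Δ ^ 2 / 2) - 2 * Δ) * (1 / 2))
      ≤ gaussVec a D + gaussVec (-a) Dᶜ := by
  set T : Set (Fin p → ℝ) := {x | |a ⬝ᵥ x| ≤ 2 * Δ} with hT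
  have hTm : MeasurableSet T := (isClosed_le (by fun_prop) continuous_const).measurableSet
  have h1 := mul_gaussVec_zero_le ha (hD.inter hTm) fun x hx =>
    (abs_le.1 (show |a ⬝ᵥ x| ≤ 2 * Δ from hx.2)).1
  have h2 := mul_gaussVec_zero_le (a := -a) (by rw [neg_dotProduct_neg, ha]) (hD.compl.inter hTm)
    fun x hx => by rw [neg_dotProduct]; linarith [(abs_le.1 (show |a ⬝ᵥ x| ≤ 2 * Δ from hx.2)).2]
  have h3 : gaussVec 0 T ≤ gaussVec 0 (D ∩ T) + gaussVec 0 (Dᶜ ∩ T) := by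
    refine (measure_mono fun x hx => ?_).trans (measure_union_le _ _)
    by_cases h : x ∈ D
    · exact Or.inl ⟨h, hx⟩
    · exact Or.inr ⟨h, hx⟩
  rw [ENNReal.ofReal_mul (Real.exp_pos _).le]
  calc _ ≤ ENNReal.ofReal (Real.exp (-(Δ ^ 2 / 2) - 2 * Δ))
        * (gaussVec 0 (D ∩ T) + gaussVec 0 (Dᶜ ∩ T)) := by
        gcongr
        exact (half_le_gaussVec_slab hΔ ha).trans h3
    _ ≤ gaussVec a (D ∩ T) + gaussVec (-a) (Dᶜ ∩ T) := by
        rw [mul_add]; exact add_le_add h1 h2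
    _ ≤ _ := add_le_add (measure_mono Set.inter_subset_left) (measure_mono Set.inter_subset_left)

/-- The label vector with the `k`-th label flipped. -/
def flipLabel (k : Fin n) (z : Labels n) : Labels n := Function.update z k (-z k)

lemma flipLabel_involutive (k : Fin n) : Function.Involutive (flipLabel k) := by
  intro z
  simp [flipLabel]

/-- Two label vectors that differ in one label cannot be told apart reliably. -/
lemma two_point_gmmLaw {θ : EuclideanSpace ℝ (Fin p)} {Δ : ℝ} (hΔ : 0 < Δ) (hθ : ‖θ‖ = Δ)
    (z : Labels n) (k : Fin n) {D : Set (Data n p)} (hD : MeasurableSet D) :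
    ENNReal.ofReal (Real.exp (-(Δ ^ 2 / 2) - 2 * Δ) * (1 / 2))
      ≤ gmmLaw θ z D + gmmLaw θ (flipLabel k z) Dᶜ := by
  obtain ⟨N, rfl⟩ : ∃ N, n = N + 1 := ⟨n - 1, by have := k.pos; omega⟩
  have hrest : (fun l => flipLabel k z (k.succAbove l)) = fun l => z (k.succAbove l) := by
    ext l; simp [flipLabel, Fin.succAbove_ne]
  have hneg : (fun j => ((flipLabel k z k : ℤ) : ℝ) * θ j) = -fun j => ((z k : ℤ) : ℝ) * θ j := by
    ext j; simp [flipLabel]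
  have ha : (fun j => ((z k : ℤ) : ℝ) * θ j) ⬝ᵥ (fun j => ((z k : ℤ) : ℝ) * θ j) = Δ ^ 2 := by
    rw [← hθ, EuclideanSpace.norm_sq_eq, dotProduct]
    refine Finset.sum_congr rfl fun j _ => ?_
    rw [Real.norm_eq_abs, sq_abs]
    linear_combination (θ j) ^ 2 * sign_mul_self (z k)
  have hins : Measurable fun q : (Fin p → ℝ) × Data N p =>
      (k.insertNth q.1 q.2 : Data (N + 1) p) :=
    (MeasurableEquiv.piFinSuccAbove (fun _ => Fin p → ℝ) k).symm.measurable
  have hslice : Measurable fun Y : Data N p => gaussVec (fun j => ((z k : ℤ) : ℝ) * θ j)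
      {x | (k.insertNth x Y : Data (N + 1) p) ∈ D} := measurable_measure_prodMk_right (hins hD)
  rw [gmmLaw_apply_slice θ z k hD, gmmLaw_apply_slice θ _ k hD.compl, hrest, hneg,
    ← lintegral_add_left hslice]
  have hconst : ENNReal.ofReal (Real.exp (-(Δ ^ 2 / 2) - 2 * Δ) * (1 / 2))
      = ∫⁻ _Y : Data N p, ENNReal.ofReal (Real.exp (-(Δ ^ 2 / 2) - 2 * Δ) * (1 / 2))
        ∂(gmmLaw θ fun l => z (k.succAbove l)) := by
    rw [lintegral_const, measure_univ, mul_one]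
  rw [hconst]
  refine lintegral_mono fun Y => ?_
  exact two_point_gaussVec hΔ ha (D := {x | (k.insertNth x Y : Data (N + 1) p) ∈ D})
    ((hins.comp measurable_prodMk_right) hD)

/-- The misclustering error controls the average pairwise disagreement. -/
lemma pairwise_le_misclustering (hn : 0 < n) (zhat z : Labels n) :
    (1 / (2 * (n : ℝ) ^ 2)) * ∑ i, ∑ k, (if zhat i * zhat k ≠ z i * z k then (1 : ℝ) else 0)
      ≤ misclustering zhat z := by
  have hn' : (0 : ℝ) < n := by exact_mod_cast hn
  refine le_ciInf fun π => ?_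
  have h1 : ∀ i k, (if zhat i * zhat k ≠ z i * z k then (1 : ℝ) else 0)
      ≤ (if π * zhat i ≠ z i then (1 : ℝ) else 0) + (if π * zhat k ≠ z k then (1 : ℝ) else 0) := by
    intro i k
    by_cases hi : π * zhat i = z i <;> by_cases hk : π * zhat k = z k
    · have : zhat i * zhat k = z i * z k := by
        rw [← hi, ← hk, mul_mul_mul_comm, Int.units_mul_self, one_mul]
      simp [this, hi, hk]
    all_goals
      simp only [ne_eq, hi, hk, not_true_eq_false, not_false_eq_true, if_true, if_false]
      split_ifs <;> norm_num
  have h2 : ∑ i, ∑ k, (if zhat i * zhat k ≠ z i * z k then (1 : ℝ) else 0)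
      ≤ 2 * n * ∑ i, (if π * zhat i ≠ z i then (1 : ℝ) else 0) := by
    refine (Finset.sum_le_sum fun i _ => Finset.sum_le_sum fun k _ => h1 i k).trans (le_of_eq ?_)
    simp only [Finset.sum_add_distrib, Finset.sum_const, Finset.card_univ, Fintype.card_fin,
      nsmul_eq_mul, ← Finset.mul_sum]
    ring
  calc _ ≤ (1 / (2 * (n : ℝ) ^ 2)) * (2 * n * ∑ i, (if π * zhat i ≠ z i then (1 : ℝ) else 0)) := by
        gcongr
    _ = _ := by field_simp

/-- The Bayes risk of every measurable rule under the uniform prior on the labels. -/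
lemma le_iSup_risk {θ : EuclideanSpace ℝ (Fin p)} {Δ : ℝ} (hΔ : 0 < Δ) (hθ : ‖θ‖ = Δ) (hn : 2 ≤ n)
    {f : Data n p → Labels n} (hf : Measurable f) :
    ENNReal.ofReal (Real.exp (-(Δ ^ 2 / 2) - 2 * Δ) * (1 / 16))
      ≤ ⨆ z : Labels n, ∫⁻ X, ENNReal.ofReal (misclustering (f X) z) ∂(gmmLaw θ z) := by
  set η := Real.exp (-(Δ ^ 2 / 2) - 2 * Δ) * (1 / 2) with hη
  have hη0 : 0 < η := by positivity
  set M := ⨆ z : Labels n, ∫⁻ X, ENNReal.ofReal (misclustering (f X) z) ∂(gmmLaw θ z) with hM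
  have hn0 : 0 < n := by omega
  have hn' : (2 : ℝ) ≤ n := by exact_mod_cast hn
  set D : Fin n → Fin n → Labels n → Set (Data n p) :=
    fun i k z => {X | f X i * f X k ≠ z i * z k} with hDdef
  have hD : ∀ i k z, MeasurableSet (D i k z) := fun i k z =>
    hf (MeasurableSet.of_discrete (s := {w : Labels n | w i * w k ≠ z i * z k}))
  have hflip : ∀ i k, i ≠ k → ∀ z, D i k (flipLabel k z) = (D i k z)ᶜ := by
    intro i k hik z
    ext X
    simp only [hDdef, flipLabel, Set.mem_ofPred_eq, Set.mem_compl_iff, Function.update_self,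
      Function.update_of_ne hik, not_not, mul_neg]
    rcases Int.units_eq_one_or (f X i * f X k) with h | h <;>
      rcases Int.units_eq_one_or (z i * z k) with h' | h' <;> rw [h, h'] <;> decide
  have hpair : ∀ i k, i ≠ k → ENNReal.ofReal (Fintype.card (Labels n) * η / 2)
      ≤ ∑ z, gmmLaw θ z (D i k z) := by
    intro i k hik
    have h1 : ∑ z, gmmLaw θ z (D i k z) = ∑ z, gmmLaw θ (flipLabel k z) (D i k z)ᶜ := by
      rw [← Equiv.sum_comp (flipLabel_involutive k).toPerm]
      refine Finset.sum_congr rfl fun z _ => ?_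
      rw [← hflip i k hik]; rfl
    have h2 : ENNReal.ofReal (Fintype.card (Labels n) * η) ≤ 2 * ∑ z, gmmLaw θ z (D i k z) := by
      rw [two_mul]
      nth_rewrite 2 [h1]
      rw [← Finset.sum_add_distrib, ENNReal.ofReal_mul (by positivity), ENNReal.ofReal_natCast]
      calc _ = ∑ _z : Labels n, ENNReal.ofReal η := by
            rw [Finset.sum_const, Finset.card_univ, nsmul_eq_mul]
        _ ≤ _ := Finset.sum_le_sum fun z _ => two_point_gmmLaw hΔ hθ z k (hD i k z)
    rw [ENNReal.ofReal_div_of_pos two_pos, ENNReal.ofReal_ofNat]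
    exact ENNReal.div_le_of_le_mul' h2
  have hrisk : ∀ z : Labels n, ∑ i, ∑ k, ENNReal.ofReal (1 / (2 * (n : ℝ) ^ 2)) * gmmLaw θ z (D i k z)
      ≤ M := by
    intro z
    refine le_trans ?_ (le_iSup (fun z : Labels n =>
      ∫⁻ X, ENNReal.ofReal (misclustering (f X) z) ∂(gmmLaw θ z)) z)
    have h1 : ∑ i, ∑ k, ENNReal.ofReal (1 / (2 * (n : ℝ) ^ 2)) * gmmLaw θ z (D i k z)
        = ∫⁻ X, ∑ i, ∑ k, (D i k z).indicator
          (fun _ => ENNReal.ofReal (1 / (2 * (n : ℝ) ^ 2))) X ∂(gmmLaw θ z) := by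
      rw [lintegral_finsetSum _ fun i _ => Finset.measurable_sum _ fun k _ =>
        measurable_const.indicator (hD i k z)]
      refine Finset.sum_congr rfl fun i _ => ?_
      rw [lintegral_finsetSum _ fun k _ => measurable_const.indicator (hD i k z)]
      refine Finset.sum_congr rfl fun k _ => ?_
      rw [lintegral_indicator_const (hD i k z)]
    rw [h1]
    refine lintegral_mono fun X => ?_
    refine le_trans (le_of_eq ?_)
      (ENNReal.ofReal_le_ofReal (pairwise_le_misclustering hn0 (f X) z))
    rw [Finset.mul_sum, ENNReal.ofReal_sum_of_nonneg fun i _ => by positivity]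
    refine Finset.sum_congr rfl fun i _ => ?_
    rw [Finset.mul_sum, ENNReal.ofReal_sum_of_nonneg fun i _ => by positivity]
    refine Finset.sum_congr rfl fun k _ => ?_
    by_cases h : f X i * f X k = z i * z k <;> simp [hDdef, h]
  have hsum : (Fintype.card (Labels n) : ℝ≥0∞) * ENNReal.ofReal (η / 8)
      ≤ Fintype.card (Labels n) * M := by
    calc (Fintype.card (Labels n) : ℝ≥0∞) * ENNReal.ofReal (η / 8)
        = ENNReal.ofReal (Fintype.card (Labels n) * (η / 8)) := by
          rw [ENNReal.ofReal_mul (by positivity), ENNReal.ofReal_natCast]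
      _ ≤ ∑ i : Fin n, ∑ k : Fin n, if i = k then 0 else ENNReal.ofReal (1 / (2 * (n : ℝ) ^ 2))
            * ENNReal.ofReal (Fintype.card (Labels n) * η / 2) := by
          have h1 : ∀ i : Fin n, (∑ k : Fin n, if i = k then (0 : ℝ≥0∞) else
              ENNReal.ofReal (1 / (2 * (n : ℝ) ^ 2))
                * ENNReal.ofReal (Fintype.card (Labels n) * η / 2))
              = ENNReal.ofReal ((n - 1) * (1 / (2 * (n : ℝ) ^ 2)
                * (Fintype.card (Labels n) * η / 2))) := by
            intro i
            rw [Finset.sum_ite, Finset.sum_const_zero, zero_add, Finset.sum_const,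
              Finset.filter_ne, Finset.card_erase_of_mem (Finset.mem_univ i), Finset.card_univ,
              Fintype.card_fin, nsmul_eq_mul, ENNReal.ofReal_mul (by linarith),
              ENNReal.ofReal_mul (by positivity), ← ENNReal.ofReal_natCast (n - 1),
              Nat.cast_sub (by omega), Nat.cast_one]
          simp_rw [h1]
          rw [Finset.sum_const, Finset.card_univ, Fintype.card_fin, nsmul_eq_mul,
            ← ENNReal.ofReal_natCast, ← ENNReal.ofReal_mul (by positivity)]
          refine ENNReal.ofReal_le_ofReal ?_
          have hcard : (0 : ℝ) ≤ Fintype.card (Labels n) * η := by positivity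
          have h2 : (n : ℝ) * ((n - 1) * (1 / (2 * (n : ℝ) ^ 2)
              * (Fintype.card (Labels n) * η / 2)))
              = (Fintype.card (Labels n) * η) * ((n - 1) / (4 * n)) := by
            field_simp; ring
          have h3 : (1 : ℝ) / 8 ≤ (n - 1) / (4 * n) := by
            rw [div_le_div_iff₀ (by norm_num) (by linarith)]; linarith
          rw [h2]
          nlinarith
      _ ≤ ∑ i : Fin n, ∑ k : Fin n, ENNReal.ofReal (1 / (2 * (n : ℝ) ^ 2))
            * ∑ z, gmmLaw θ z (D i k z) := by
          refine Finset.sum_le_sum fun i _ => Finset.sum_le_sum fun k _ => ?_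
          split_ifs with h
          · exact zero_le
          · gcongr
            exact hpair i k h
      _ = ∑ z, ∑ i, ∑ k, ENNReal.ofReal (1 / (2 * (n : ℝ) ^ 2)) * gmmLaw θ z (D i k z) := by
          simp_rw [Finset.mul_sum]
          rw [Finset.sum_comm]
          conv_rhs => rw [Finset.sum_comm]; enter [2, i]; rw [Finset.sum_comm]
          rw [Finset.sum_comm]
      _ ≤ ∑ _z : Labels n, M := Finset.sum_le_sum fun z _ => hrisk z
      _ = _ := by rw [Finset.sum_const, Finset.card_univ, nsmul_eq_mul]
  have hfin := (ENNReal.mul_le_mul_iff_right (by simp)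
    (ENNReal.natCast_ne_top _)).1 hsum
  refine le_trans (le_of_eq ?_) hfin
  rw [hη]; congr 1; ring

lemma exists_mem_centres_norm_eq {s : ℕ} {κ Δ : ℝ} (hΔ : 0 < Δ) (h : (centres p s κ Δ).Nonempty) :
    ∃ θ ∈ centres p s κ Δ, ‖θ‖ = Δ := by
  obtain ⟨θ, h1, h2, h3⟩ := h
  have hpos : 0 < ‖θ‖ := hΔ.trans_le h1
  have hc0 : 0 < Δ / ‖θ‖ := by positivity
  have hc1 : Δ / ‖θ‖ ≤ 1 := (div_le_one hpos).2 h1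
  have hnorm : ‖(Δ / ‖θ‖) • θ‖ = Δ := by
    rw [norm_smul, Real.norm_of_nonneg hc0.le, div_mul_cancel₀ _ hpos.ne']
  refine ⟨(Δ / ‖θ‖) • θ, ⟨hnorm.ge, ?_, fun j => ?_⟩, hnorm⟩
  · refine le_trans (le_of_eq ?_) h2
    unfold l0norm
    congr 1
    ext j
    simp [hpos.ne', hΔ.ne']
  · rw [PiLp.smul_apply, smul_eq_mul, abs_mul, abs_of_pos hc0]
    exact (mul_le_of_le_one_left (abs_nonneg _) hc1).trans (h3 j)

theorem minimax_lower_bound :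
    ∃ δ : ℝ → ℝ, Tendsto δ atTop (𝓝 0) ∧
      ∀ (n p s : ℕ) (κ Δ : ℝ), 2 ≤ n → 0 < Δ → (centres p s κ Δ).Nonempty →
        ENNReal.ofReal (Real.exp (-(Δ ^ 2 / 2 * (1 - δ Δ)))) ≤ minimaxRisk n p s κ Δ := by
  refine ⟨fun Δ => -(4 * Δ⁻¹ + 8 * (Δ⁻¹) ^ 2), ?_, fun n p s κ Δ hn hΔ hne => ?_⟩
  · have h := tendsto_inv_atTop_zero (𝕜 := ℝ)
    simpa using ((h.const_mul 4).add ((h.pow 2).const_mul 8)).neg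
  · obtain ⟨θ, hθ, hnorm⟩ := exists_mem_centres_norm_eq hΔ hne
    refine le_iInf₂ fun zhat hz => le_iSup₂_of_le θ hθ ?_
    refine le_trans (ENNReal.ofReal_le_ofReal ?_) (le_iSup_risk hΔ hnorm hn (hz θ))
    have h1 : -(Δ ^ 2 / 2 * (1 - -(4 * Δ⁻¹ + 8 * (Δ⁻¹) ^ 2))) = (-(Δ ^ 2 / 2) - 2 * Δ) + -4 := by
      field_simp; ring
    simp only
    rw [h1, Real.exp_add]
    gcongr
    have h2 : (2 : ℝ) ≤ Real.exp 1 := by linarith [Real.add_one_le_exp (1 : ℝ)]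
    have h3 : (16 : ℝ) ≤ Real.exp 4 := by
      have : Real.exp 4 = Real.exp 1 ^ 4 := by rw [← Real.exp_nat_mul]; norm_num
      rw [this]
      calc (16 : ℝ) = 2 ^ 4 := by norm_num
        _ ≤ _ := by gcongr
    rw [Real.exp_neg, one_div]
    exact inv_anti₀ (by norm_num) h3

end LowerBound

end SparseClustering

theorem theorem1 :
    -- the upper bound for sparse spectral clustering
    (∃ C₀ : ℝ, 0 < C₀ ∧ ∀ C : ℝ, C₀ ≤ C → ∃ c : ℝ, 0 < c ∧ ∃ c' : ℝ, 0 < c' ∧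
      ∀ (n p s : ℕ) (θ : EuclideanSpace ℝ (Fin p)) (z : SparseClustering.Labels n)
        (κ lam τ : ℝ),
        θ ≠ 0 →
        SparseClustering.l0norm θ ≤ s →
        Real.log p ≤ n →
        0 < κ → (∀ j, |θ j| ≤ κ) → κ ≤ √(Real.log p) →
        lam = C * (1 + κ) * √(Real.log p / n) →
        0 ≤ τ → τ ^ 2 = (s : ℝ) ^ 2 * Real.log p * (1 + κ ^ 2) / (n * ‖θ‖ ^ 4) →
        τ ^ 2 ≤ c →
        ∃ A : Set (SparseClustering.Data n p), MeasurableSet A ∧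
          ENNReal.ofReal (1 - 8 / (p : ℝ) - 2 * Real.exp (-‖θ‖ / 2))
            ≤ SparseClustering.gmmLaw θ z A ∧
          ∀ X ∈ A,
            (∃ zhat, SparseClustering.IsSparseSpectralOutput X lam zhat) ∧
            ∀ zhat, SparseClustering.IsSparseSpectralOutput X lam zhat →
              SparseClustering.misclustering zhat z
                ≤ 2 * Real.exp (-(‖θ‖ ^ 2 / 2 * (1 - c' * τ - ‖θ‖⁻¹)))) ∧
    -- optimality: the matching minimax lower bound
    (∃ δ : ℝ → ℝ, Tendsto δ atTop (𝓝 0) ∧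
      ∀ (n p s : ℕ) (κ Δ : ℝ), 2 ≤ n → 0 < Δ →
        (SparseClustering.centres p s κ Δ).Nonempty →
        ENNReal.ofReal (Real.exp (-(Δ ^ 2 / 2 * (1 - δ Δ))))
          ≤ SparseClustering.minimaxRisk n p s κ Δ) := by
  refine ⟨⟨14, by norm_num, fun C hC => ?_⟩, SparseClustering.minimax_lower_bound⟩
  have hC0 : 0 < C := by linarith
  refine ⟨(1 / (32 * C)) ^ 2, by positivity, 8 * C + 864, by positivity, ?_⟩
  intro n p s θ z κ lam τ hθ hs hlog hκ0 hκ hκL hlam hτ0 hτ hτc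
  exact SparseClustering.sparse_spectral_upper_bound hC hθ hs hlog hκ0 hκ hκL hlam hτ0 hτ hτc
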